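/- **Setting.** Let $B$ be a stationary, properly ordered Bratteli diagram: $V_0=\{v_0\}$, $V_n=\{1,\dots,m\}$ for $n\ge 1$, finite edge sets $E_n$ from $V_{n-1}$ to $V_n$ with source and terminal maps $\mathbf s,\mathbf t$, a linear order on each set of edges with a common terminal vertex, and all the ordered edge sets $E_n$, $n\ge 2$, identified with one another; properly ordered means that there are exactly one infinite path of maximal edges and exactly one infinite path of minimal edges. Let $X_B$ be the space of infinite paths $x=(x_1,x_2,\dots)$ from $v_0$, assumed infinite (so that it is a Cantor set). The Vershik map $V_B:X_B\to X_B$ replaces the first non-maximal edge of $x$ by its successor and the edges before it by minimal edges, and sends the maximal path to the minimal one. Let $M_{i,j}$ be the number of edges from $i$ to $j$ in $E_n$ $(n\ge2)$, and assume: (H1) $M_{i,j}>0$ for all $i,j$; (H2) each $i\in V_1$ receives exactly one edge from $v_0$; (H3) each minimal edge of $E_n$, $n\ge 2$, starts at the vertex $1$. Let $\lambda$ be the Perron eigenvalue of $M$ and $r,l$ strictly positive right and left eigenvectors for $\lambda$, with $\sum_i r(i)=1$ and $\sum_i l(i)r(i)=1$. Let $\mu$ be the $V_B$-invariant Borel probability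 measure on $X_B$. For $I\subseteq X_B$ put $N_I^{(0)}=0$, $N^{(k)}_I(x)=\inf\{n>N^{(k-1)}_I(x):V_B^n x\in I\}$, and $$F_I^{(k)}(t)=\mu\{x:\mu(I)\,(N_I^{(k)}(x)-N_I^{(k-1)}(x))\le t\}\qquad(k\ge1).$$ Fix $x^*\in X_B$, let $I_n=[x_1^*,\dots,x_n^*]$ be the cylinder of the paths that begin with $x^*_1\dots x^*_n$, write $F_n^{(k)}=F_{I_n}^{(k)}$, and let $\mathcal N\subseteq\{1,2,\dots\}$ be an infinite set such that $\mathbf t(x_n^*)=i^*$ for all $n\in\mathcal N$, for a fixed vertex $i^*$. Let $E(a,b)$ be the set of paths $e_a\dots e_b$ with $e_q\in E_q$; by stationarity $E(n+1,n+q)$ is identified with $E(2,q+1)$ for $n\ge1$. **Theorem 2.4.** (a) For every path $ef\in E(2,3)$ with $\mathbf s(e)=i^*$ there is a vector $c(ef)\in\mathbb N^m$ such that, for every $n\ge 1$, every cylinder $I=[x_1,\dots,x_n]$ with $\mathbf t(x_n)=i^*$ and every $z\in[Ief]$, $c(ef)(i)$ is the number of times $0\le q<N_I^{(1)}(z)$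 at which $V_B^q z$ lies in the cylinder of the minimal path from $v_0$ to $i\in V_n$. For every $k\ge1$ and every $e_1\dots e_{k+1}\in E(2,k+2)$ with $\mathbf s(e_1)=i^*$ there is a path $e_1^{(k)}e_2^{(k)}\in E(2,3)$ with $\mathbf s(e_1^{(k)})=i^*$ such that $V_B^{N_I^{(k-1)}(z)}(z)\in[Ie_1^{(k)}e_2^{(k)}]$ for all such $n$, $I$ and all $z\in[Ie_1\dots e_{k+1}]$. Put $\bar c(ef)=\sum_i c(ef)(i)\,l(i)$, let $c_1<\dots<c_L$ be the distinct values of $\bar c(ef)$ over the paths $ef\in E(2,3)$ with $\mathbf s(e)=i^*$, let $S(j)$ be the set of those paths with $\bar c(ef)=c_j$, and put $d_0=0$, $d_j=c_j\,r(i^*)$ for $1\le j\le L$, $d_{L+1}=\infty$. (b) For $0\le j\le L$ and $d_j\le t<d_{j+1}$, $$\lim_{n\to\infty,\,n\in\mathcal N}F_n^{(1)}(t)=\sum_{ef\in\bigcup_{i=1}^jS(i)}\bar c(ef)\frac{r(\mathbf t(f))}{\lambda^2}+\frac{t}{r(i^*)}\sum_{ef\in\bigcup_{i=j+1}^LS(i)}\frac{r(\mathbf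 t(f))}{\lambda^2}.$$ (c) For $k\ge2$, $0\le j\le L$ and $d_j\le t<d_{j+1}$, with $t\ne d_j$ if $j\ge1$, $$\lim_{n\to\infty,\,n\in\mathcal N}F_n^{(k)}(t)=\sum_{\substack{e_1\dots e_{k+1}\in E(2,k+2):\ \mathbf s(e_1)=i^*,\\ e_1^{(k)}e_2^{(k)}\in\bigcup_{i=1}^jS(i)}}\bar c(e_1e_2)\frac{r(\mathbf t(e_{k+1}))}{\lambda^{k+1}}.$$ (d) For each $k\ge1$ and $0\le j\le L$, the convergence of $F_n^{(k)}$ along $\mathcal N$ is uniform on every closed set $K\subseteq\,]d_j,d_{j+1}[$ (closed in $\mathbb R$), in particular on every closed interval contained in $]d_j,d_{j+1}[$. -/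

import Mathlib

open MeasureTheory

/-- An ordered Bratteli diagram. `V n` is the finite set of vertices of level `n`, and `E n` is the
finite set of edges from `V n` to `V (n + 1)`, usually written `E_{n+1}`. Two edges are comparable
iff they have the same terminal vertex. -/
structure OrderedBratteliDiagram where
  V : ℕ → Type
  E : ℕ → Type
  s : ∀ n, E n → V n
  t : ∀ n, E n → V (n + 1)
  finV : ∀ n, Finite (V n)
  finE : ∀ n, Finite (E n)
  root : Nonempty (Unique (V 0))
  s_surj : ∀ n, Function.Surjective (s n)
  t_surj : ∀ n, Function.Surjective (t n)
  ord : ∀ n, PartialOrder (E n)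
  comparable_iff : ∀ n (e f : E n), (e ≤ f ∨ f ≤ e) ↔ t n e = t n f

namespace OrderedBratteliDiagram

attribute [instance] ord finV finE

variable (B : OrderedBratteliDiagram)

/-- The space `X_B` of infinite paths starting at the root; the `n`-th edge is `x.1 (n - 1)`. -/
def Path : Type := {x : ∀ n, B.E n // ∀ n, B.t n (x n) = B.s (n + 1) (x (n + 1))}

variable {B}

/-- The cylinder `[x₁, …, xₙ]`. -/
def cyl (x : B.Path) (n : ℕ) : Set B.Path := {y | ∀ i < n, y.1 i = x.1 i}

/-- The σ-algebra generated by the cylinders. The cylinders are a countable base of the topology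
of `X_B`, so this is the Borel σ-algebra. -/
instance : MeasurableSpace B.Path :=
  MeasurableSpace.generateFrom {A | ∃ (x : B.Path) (n : ℕ), A = cyl x n}

/-- All edges of the path are maximal. -/
def AllMax (x : B.Path) : Prop := ∀ n, IsMax (x.1 n)

/-- All edges of the path are minimal. -/
def AllMin (x : B.Path) : Prop := ∀ n, IsMin (x.1 n)

variable (B) in
/-- There is exactly one path of maximal edges and exactly one path of minimal edges. -/
def ProperlyOrdered : Prop := (∃! x : B.Path, AllMax x) ∧ (∃! x : B.Path, AllMin x)

/-- `y` arises from `x` by replacing the first non-maximal edge `x_k` by its successor, and all the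
edges before it by minimal edges. -/
def IsSucc (x y : B.Path) : Prop :=
  ∃ k, (∀ i < k, IsMax (x.1 i)) ∧ x.1 k ⋖ y.1 k ∧ (∀ i < k, IsMin (y.1 i)) ∧
    ∀ i, k < i → y.1 i = x.1 i

theorem exists_min_edge (n : ℕ) (v : B.V (n + 1)) : ∃ e : B.E n, IsMin e ∧ B.t n e = v := by
  obtain ⟨e, he⟩ := B.t_surj n v
  obtain ⟨f, hf, hm⟩ := (Set.toFinite {g : B.E n | g ≤ e}).exists_minimal ⟨e, le_refl e⟩
  refine ⟨f, fun g hg => hm (le_trans hg hf) hg, ?_⟩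
  rw [← he]
  exact (B.comparable_iff n f e).1 (Or.inl hf)

theorem exists_min_prefix (x : B.Path) (k : ℕ) (f : B.E k) :
    ∃ p : ∀ n, B.E n, p k = f ∧
      ∀ n < k, IsMin (p n) ∧ B.t n (p n) = B.s (n + 1) (p (n + 1)) := by
  induction k with
  | zero => exact ⟨Function.update x.1 0 f, by simp, by simp⟩
  | succ k ih =>
    obtain ⟨g, hg, hgt⟩ := exists_min_edge k (B.s (k + 1) f)
    obtain ⟨p, hp, hq⟩ := ih g
    refine ⟨Function.update p (k + 1) f, by simp, fun n hn => ?_⟩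
    rcases Nat.lt_succ_iff_lt_or_eq.1 hn with h | h
    · have h1 : n ≠ k + 1 := by omega
      have h2 : n + 1 ≠ k + 1 := by omega
      simpa [Function.update_of_ne h1, Function.update_of_ne h2] using hq n h
    · subst h
      have h1 : n ≠ n + 1 := by omega
      simp [hp, hg, hgt]

theorem exists_succ (x : B.Path) (hx : ¬ AllMax x) : ∃ y, IsSucc x y := by
  classical
  have hx' : ∃ n, ¬ IsMax (x.1 n) := by simpa [AllMax] using hx
  have hk := Nat.find_spec hx'
  have hlt : ∀ i < Nat.find hx', IsMax (x.1 i) := fun i hi => not_not.1 (Nat.find_min hx' hi)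
  generalize Nat.find hx' = k at hk hlt
  obtain ⟨g, hg⟩ := not_isMax_iff.1 hk
  obtain ⟨f, hf, hm⟩ := (Set.toFinite {g : B.E k | x.1 k < g}).exists_minimal ⟨g, hg⟩
  have hcov : x.1 k ⋖ f := ⟨hf, fun c hc hcf => absurd (hm hc hcf.le) (not_le_of_gt hcf)⟩
  have htf : B.t k f = B.t k (x.1 k) := (B.comparable_iff k _ _).1 (Or.inr hcov.le)
  obtain ⟨p, hp, hq⟩ := exists_min_prefix x k f
  refine ⟨⟨fun n => if n ≤ k then p n else x.1 n, fun n => ?_⟩, k, hlt, ?_, ?_, ?_⟩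
  · rcases lt_trichotomy n k with h | h | h
    · have h2 : n + 1 ≤ k := h
      simpa [h.le, h2] using (hq n h).2
    · subst h
      simpa [hp, htf] using x.2 n
    · have h1 : ¬ n ≤ k := by omega
      have h2 : ¬ n + 1 ≤ k := by omega
      simpa [h1, h2] using x.2 n
  · simpa [hp] using hcov
  · intro i hi
    simpa [hi.le] using (hq i hi).1
  · intro i hi
    have h1 : ¬ i ≤ k := by omega
    simp [h1]

open Classical in
/-- The Vershik map `V_B` of a properly ordered diagram. (The path `y` with `IsSucc x y` is
unique; the path of maximal edges is sent to the path of minimal edges.) -/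
noncomputable def vershik (hB : B.ProperlyOrdered) (x : B.Path) : B.Path :=
  if h : AllMax x then hB.2.choose else (exists_succ x h).choose

end OrderedBratteliDiagram

/-- `entranceTime T I k x` is `N_I^{(k)}(x)`: `N^{(0)} = 0` and, for `k ≥ 0`,
`N^{(k+1)}(x) = inf {n > N^{(k)}(x) : T^n x ∈ I}`. -/
noncomputable def entranceTime {X : Type*} (T : X → X) (I : Set X) : ℕ → X → ℕ
  | 0, _ => 0
  | k + 1, x => sInf {n | entranceTime T I k x < n ∧ T^[n] x ∈ I}

/-- For `k ≥ 1`, `entranceLaw T μ I k` is the distribution function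
`F_I^{(k)}(t) = μ {x : μ(I) (N_I^{(k)}(x) - N_I^{(k-1)}(x)) ≤ t}`; for `k = 1` the subtracted term
is `N_I^{(0)} = 0`. -/
noncomputable def entranceLaw {X : Type*} [MeasurableSpace X] (T : X → X) (μ : Measure X)
    (I : Set X) (k : ℕ) (u : ℝ) : ℝ :=
  μ.real {x | μ.real I * ((entranceTime T I k x : ℝ) - (entranceTime T I (k - 1) x : ℝ)) ≤ u}

/-- A stationary ordered Bratteli diagram with vertex sets `V_n = {1, …, m}` for `n ≥ 1`
(labelled here `0, …, m - 1`). `E₁` is the set of edges from the root to `V_1`; all the ordered edge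
sets `E_n`, `n ≥ 2`, are identified with `E`. -/
structure StationaryDiagram (m : ℕ) where
  E₁ : Type
  E : Type
  t₁ : E₁ → Fin m
  s : E → Fin m
  t : E → Fin m
  finE₁ : Fintype E₁
  finE : Fintype E
  nonempty : Nonempty E₁
  t₁_surj : Function.Surjective t₁
  s_surj : Function.Surjective s
  t_surj : Function.Surjective t
  ord₁ : PartialOrder E₁
  ord : PartialOrder E
  comparable_iff₁ : ∀ e f : E₁, (e ≤ f ∨ f ≤ e) ↔ t₁ e = t₁ f
  comparable_iff : ∀ e f : E, (e ≤ f ∨ f ≤ e) ↔ t e = t f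

namespace StationaryDiagram

attribute [instance] ord₁ ord finE₁ finE

variable {m : ℕ} (S : StationaryDiagram m)

/-- The underlying ordered Bratteli diagram. -/
def toDiagram : OrderedBratteliDiagram where
  V := fun n => match n with
    | 0 => Unit
    | _ + 1 => Fin m
  E := fun n => match n with
    | 0 => S.E₁
    | _ + 1 => S.E
  s := fun n => match n with
    | 0 => fun _ => ()
    | _ + 1 => S.s
  t := fun n => match n with
    | 0 => S.t₁
    | _ + 1 => S.t
  finV := fun n => match n with
    | 0 => inferInstanceAs (Finite Unit)
    | _ + 1 => inferInstanceAs (Finite (Fin m))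
  finE := fun n => match n with
    | 0 => inferInstanceAs (Finite S.E₁)
    | _ + 1 => inferInstanceAs (Finite S.E)
  root := ⟨inferInstanceAs (Unique Unit)⟩
  s_surj := fun n => match n with
    | 0 => fun _ => S.nonempty.elim fun e => ⟨e, rfl⟩
    | _ + 1 => S.s_surj
  t_surj := fun n => match n with
    | 0 => S.t₁_surj
    | _ + 1 => S.t_surj
  ord := fun n => match n with
    | 0 => S.ord₁
    | _ + 1 => S.ord
  comparable_iff := fun n => match n with
    | 0 => S.comparable_iff₁
    | _ + 1 => S.comparable_iff

/-- The path space `X_B`. -/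
abbrev X : Type := S.toDiagram.Path

/-- The incidence matrix: `M i j` is the number of edges from `i ∈ V_n` to `j ∈ V_{n+1}`, for any
`n ≥ 1`. -/
noncomputable def M : Matrix (Fin m) (Fin m) ℝ :=
  fun i j => (Nat.card {e : S.E // S.s e = i ∧ S.t e = j} : ℝ)

/-- The incidence matrix has strictly positive coefficients. -/
def H1 : Prop := ∀ i j, 0 < S.M i j

/-- Every vertex of `V_1` receives a unique edge from the root. -/
def H2 : Prop := ∀ i : Fin m, ∃! e : S.E₁, S.t₁ e = i

/-- Every minimal edge starts at the first vertex (for the edges in `E₁` there is nothing to ask). -/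
def H3 [NeZero m] : Prop := ∀ e : S.E, IsMin e → S.s e = 0

variable {S}

/-- The edge of `x` in `E_{k+2}`, i.e. `x_{k+2}`. -/
def edge (x : S.X) (k : ℕ) : S.E := x.1 (k + 1)

/-- The terminal vertex, in `V_{p+1}`, of the edge `x_{p+1}`. -/
def term (x : S.X) (p : ℕ) : Fin m := S.toDiagram.t p (x.1 p)

/-- `n ≥ 1` and the terminal vertex of `x_n` is `v`. -/
def EndsAt (x : S.X) (n : ℕ) (v : Fin m) : Prop := ∃ p, n = p + 1 ∧ term x p = v

/-- The cylinder of the minimal path from the root to `i ∈ V_{p+1}`. -/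
def minCyl (p : ℕ) (i : Fin m) : Set S.X := {y | (∀ q ≤ p, IsMin (y.1 q)) ∧ term y p = i}

variable (S)

/-- `c` is the family of vectors `c(ef)`: for every `n = p + 1 ≥ 1`, every cylinder
`I = [x₁, …, xₙ]` ending at `v`, and every point `z ∈ [I e f]`, the number `c e f i` counts how many
times the trajectory of `z` passes through the minimal path from the root to `i ∈ V_n` before coming
back to `I`. -/
def IsPassageCount (hS : S.toDiagram.ProperlyOrdered) (v : Fin m) (c : S.E → S.E → Fin m → ℕ) :
    Prop :=
  ∀ (p : ℕ) (x : S.X), term x p = v → ∀ z ∈ OrderedBratteliDiagram.cyl x (p + 1),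
    ∀ i : Fin m, c (edge z p) (edge z (p + 1)) i =
      Set.ncard {q : ℕ |
        q < entranceTime (OrderedBratteliDiagram.vershik hS)
          (OrderedBratteliDiagram.cyl x (p + 1)) 1 z ∧
        (OrderedBratteliDiagram.vershik hS)^[q] z ∈ minCyl p i}

/-- `g` assigns to the paths `e₁ … e_{k+1}` the paths `e₁^{(k)} e₂^{(k)}`: for every `n = p + 1 ≥ 1`,
every cylinder `I = [x₁, …, xₙ]` ending at `v`, every `k ≥ 1`, and every `z ∈ [I e₁ … e_{k+1}]`, the
point `V_B^{N_I^{(k-1)}(z)}(z)` belongs to `[I e₁^{(k)} e₂^{(k)}]`. -/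
def IsReturnPath (hS : S.toDiagram.ProperlyOrdered) (v : Fin m)
    (g : ∀ k : ℕ, (Fin (k + 1) → S.E) → S.E × S.E) : Prop :=
  ∀ (p : ℕ) (x : S.X), term x p = v → ∀ z ∈ OrderedBratteliDiagram.cyl x (p + 1),
    ∀ k : ℕ, 1 ≤ k → ∀ w : S.X,
      w = (OrderedBratteliDiagram.vershik hS)^[entranceTime (OrderedBratteliDiagram.vershik hS)
        (OrderedBratteliDiagram.cyl x (p + 1)) (k - 1) z] z →
      w ∈ OrderedBratteliDiagram.cyl x (p + 1) ∧
        g k (fun a => edge z (p + a)) = (edge w p, edge w (p + 1))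

variable {S}

/-- `c̄(ef) = ∑ i, c(ef)(i) l(i)`, for a pair of edges `a = (e, f)`. -/
noncomputable def cbar (c : S.E → S.E → Fin m → ℕ) (l : Fin m → ℝ) (a : S.E × S.E) : ℝ :=
  ∑ i, (c a.1 a.2 i : ℝ) * l i

variable (S) in
open Classical in
/-- The paths `e₁ … e_q` of stationary edges with `s(e₁) = v`, for `q = k + 1`. -/
noncomputable def pathsFrom (v : Fin m) (k : ℕ) : Finset (Fin (k + 1) → S.E) :=
  {e | S.s (e 0) = v ∧ ∀ a : Fin k, S.t (e a.castSucc) = S.s (e a.succ)}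

variable (S) in
open Classical in
/-- The paths `ef` with `s(e) = v`. -/
noncomputable def pairsFrom (v : Fin m) : Finset (S.E × S.E) :=
  {a | S.s a.1 = v ∧ S.t a.1 = S.s a.2}

/-- The finite set `{c_1 < ⋯ < c_L}` of the values `c̄(ef)`, for the paths `ef` with `s(e) = v`. -/
noncomputable def cvals (v : Fin m) (c : S.E → S.E → Fin m → ℕ) (l : Fin m → ℝ) : Finset ℝ :=
  (S.pairsFrom v).image (cbar c l)

/-- `d_0 = 0`, `d_j = c_j r(v)` for `1 ≤ j ≤ L`, and `d_j = ∞` for `j > L`. -/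
noncomputable def d (v : Fin m) (c : S.E → S.E → Fin m → ℕ) (l r : Fin m → ℝ) : ℕ → EReal
  | 0 => 0
  | j + 1 => if h : j < (cvals v c l).card then
      (((cvals v c l).orderEmbOfFin rfl ⟨j, h⟩ * r v : ℝ) : EReal) else ⊤

open Classical in
/-- `Sset v c l j` is `S(j) = {ef : s(e) = v, c̄(ef) = c_j}` for `1 ≤ j ≤ L`, and empty otherwise. -/
noncomputable def Sset (v : Fin m) (c : S.E → S.E → Fin m → ℕ) (l : Fin m → ℝ) :
    ℕ → Finset (S.E × S.E)
  | 0 => ∅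
  | j + 1 => if h : j < (cvals v c l).card then
      {a ∈ S.pairsFrom v | cbar c l a = (cvals v c l).orderEmbOfFin rfl ⟨j, h⟩} else ∅

open Classical in
/-- The formula for `F^{(1)}` on `[d_j, d_{j+1}[`. -/
noncomputable def limitLaw₁ (v : Fin m) (c : S.E → S.E → Fin m → ℕ) (lam : ℝ) (l r : Fin m → ℝ)
    (j : ℕ) (u : ℝ) : ℝ :=
  ∑ a ∈ (Finset.Icc 1 j).biUnion (Sset v c l), cbar c l a * (r (S.t a.2) / lam ^ 2) +
    u / r v * ∑ a ∈ (Finset.Icc (j + 1) (cvals v c l).card).biUnion (Sset v c l),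
      r (S.t a.2) / lam ^ 2

open Classical in
/-- The formula for `F^{(k)}`, `k ≥ 2`, on the interval from `d_j` to `d_{j+1}`. -/
noncomputable def limitLaw (v : Fin m) (c : S.E → S.E → Fin m → ℕ)
    (g : ∀ k : ℕ, (Fin (k + 1) → S.E) → S.E × S.E) (lam : ℝ) (l r : Fin m → ℝ) (k j : ℕ) : ℝ :=
  ∑ e ∈ S.pathsFrom v k with g k e ∈ (Finset.Icc 1 j).biUnion (Sset v c l),
    cbar c l (e 0, e 1) * (r (S.t (e (Fin.last k))) / lam ^ (k + 1))

end StationaryDiagram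

/-! By (H2) a path is the sequence of its stationary edges, and the Vershik map is an odometer on
such sequences: the edges are digits and the tower heights `hgt` are weights. Split a path at level
p + 1 into the `rank` of its initial segment and the `tail` behind it. Stationarity makes the tail a
point of the same space, and `isSuspension_tail` says that the Vershik map is a suspension of
itself: the rank climbs to the roof `hgt S p`, then the tail moves by the Vershik map.

A cylinder I ending at v is one level of this suspension above `startSet v`, so its returns are
governed by the returns of the tail to `startSet v`, a system that depends neither on n nor on I.
(H1) and (H3) make each such return depend on finitely many edges (`Agree.iterate`): two edges fix
an excursion, and k + 1 edges fix the two edges at the start of the k-th one. Hence the vectors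
c(ef), the paths in (a), and the return time ∑ c(ef)(i) `hgt S p i`.

Contraction by positive matrices yields the two asymptotic facts: heights grow like `l i * lam ^ p`
(`tendsto_hgt`), and a cylinder of p + 1 edges ending at v has measure exactly `r v / lam ^ p`
(`measureReal_cyl`). A normalised return time therefore tends to c̄(ef) r(v), which explains the
thresholds d_j.

Invariance of μ turns entrance laws into sums over excursions (`measureReal_entranceTime_eq`). An
excursion of length τ over an atom D contributes min(τ, u) μ(D) to the first law, and its full mass
τ μ(D) to a later law if the relevant gap is short enough. The first limit is continuous in t, so
thresholds do no harm. The later limits are step functions, and convergence is uniform on closed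
sets that avoid the jumps. -/

namespace StationaryDiagram

variable {m : ℕ} {S : StationaryDiagram m}

/-! ### Paths as sequences of stationary edges -/

theorem term_succ (z : S.X) (k : ℕ) : term z (k + 1) = S.t (edge z k) := rfl

theorem term_eq_source (z : S.X) (k : ℕ) : term z k = S.s (edge z k) := z.2 k

theorem target_edge (z : S.X) (k : ℕ) : S.t (edge z k) = S.s (edge z (k + 1)) := z.2 (k + 1)

theorem first_edge_eq (h2 : S.H2) {z w : S.X} (h : term z 0 = term w 0) : z.1 0 = w.1 0 :=
  (h2 (term w 0)).unique h rfl

/-- The path with a given sequence of stationary edges. -/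
noncomputable def ofEdges (h2 : S.H2) (f : ℕ → S.E) (hf : ∀ k, S.t (f k) = S.s (f (k + 1))) : S.X :=
  ⟨fun n => match n with
    | 0 => (h2 (S.s (f 0))).choose
    | k + 1 => f k, fun n => match n with
    | 0 => (h2 (S.s (f 0))).choose_spec.1
    | k + 1 => hf k⟩

theorem edge_ofEdges (h2 : S.H2) (f : ℕ → S.E) (hf : ∀ k, S.t (f k) = S.s (f (k + 1))) (k : ℕ) :
    edge (ofEdges h2 f hf) k = f k := rfl

theorem path_ext (h2 : S.H2) {z w : S.X} (h : ∀ k, edge z k = edge w k) : z = w := by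
  apply Subtype.ext
  funext n
  cases n with
  | zero => exact first_edge_eq h2 (by rw [term_eq_source, term_eq_source, h])
  | succ k => exact h k

/-- The path obtained by forgetting the edges between the root and the level `p + 1`. -/
noncomputable def tail (h2 : S.H2) (p : ℕ) (z : S.X) : S.X :=
  ofEdges h2 (fun k => edge z (p + k)) fun k => target_edge z (p + k)

theorem edge_tail (h2 : S.H2) (p : ℕ) (z : S.X) (k : ℕ) :
    edge (tail h2 p z) k = edge z (p + k) := rfl

theorem term_tail (h2 : S.H2) (p : ℕ) (z : S.X) (k : ℕ) :
    term (tail h2 p z) k = term z (p + k) := by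
  rw [term_eq_source, term_eq_source, edge_tail]

/-! ### The order on the edges -/

theorem target_eq_of_le {e f : S.E} (h : e ≤ f) : S.t e = S.t f :=
  (S.comparable_iff e f).1 (Or.inl h)

theorem le_or_lt_of_target_eq {e f : S.E} (h : S.t e = S.t f) : e ≤ f ∨ f < e := by
  rcases (S.comparable_iff e f).2 h with h' | h'
  · exact Or.inl h'
  · rcases h'.eq_or_lt with h'' | h''
    · exact Or.inl h''.ge
    · exact Or.inr h''

theorem le_of_lt_of_covBy {e f g : S.E} (h : e ⋖ f) (hg : g < f) : g ≤ e := by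
  have ht : S.t g = S.t e := (target_eq_of_le hg.le).trans (target_eq_of_le h.le).symm
  exact (le_or_lt_of_target_eq ht).resolve_right fun h' => h.2 h' hg

theorem le_of_isMax {e f : S.E} (h : IsMax e) (ht : S.t f = S.t e) : f ≤ e :=
  (le_or_lt_of_target_eq ht).resolve_right fun h' => h.not_lt h'

theorem isMin_first_edge (h2 : S.H2) (z : S.X) : IsMin (z.1 0) := by
  intro e he
  have : S.t₁ e = S.t₁ (z.1 0) := (S.comparable_iff₁ e (z.1 0)).1 (Or.inl he)
  exact ((h2 _).unique this rfl).ge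

theorem covBy_unique {e f g : S.E} (hf : e ⋖ f) (hg : e ⋖ g) : f = g := by
  have ht : S.t f = S.t g := (target_eq_of_le hf.le).symm.trans (target_eq_of_le hg.le)
  rcases le_or_lt_of_target_eq ht with h | h
  · exact h.eq_or_lt.resolve_right fun h' => hg.2 hf.1 h'
  · exact absurd h (hf.2 hg.1)

/-! ### The Vershik map in terms of the stationary edges -/

/-- Under (H2) no root edge has a successor, so a carry never stops at the first edge and the
stationary edges suffice to describe the map. -/
theorem vershik_spec (hS : S.toDiagram.ProperlyOrdered) (h2 : S.H2) (z : S.X) :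
    ((∀ k, IsMax (edge z k)) ∧ ∀ k, IsMin (edge (OrderedBratteliDiagram.vershik hS z) k)) ∨
    ∃ k, (∀ i < k, IsMax (edge z i)) ∧
      edge z k ⋖ edge (OrderedBratteliDiagram.vershik hS z) k ∧
      (∀ i < k, IsMin (edge (OrderedBratteliDiagram.vershik hS z) i)) ∧
      ∀ i, k < i → edge (OrderedBratteliDiagram.vershik hS z) i = edge z i := by
  by_cases h : OrderedBratteliDiagram.AllMax z
  · left
    have : OrderedBratteliDiagram.vershik hS z = hS.2.choose := dif_pos h
    rw [this]
    exact ⟨fun k => h (k + 1), fun k => hS.2.choose_spec.1 (k + 1)⟩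
  · right
    have hv : OrderedBratteliDiagram.vershik hS z = (OrderedBratteliDiagram.exists_succ z h).choose :=
      dif_neg h
    have hs := (OrderedBratteliDiagram.exists_succ z h).choose_spec
    rw [← hv] at hs
    generalize OrderedBratteliDiagram.vershik hS z = w at hs
    obtain ⟨k, h₁, h₂, h₃, h₄⟩ := hs
    cases k with
    | zero =>
      exfalso
      have ht : S.toDiagram.t 0 (z.1 0) = S.toDiagram.t 0 (w.1 0) :=
        (S.toDiagram.comparable_iff 0 _ _).1 (Or.inl h₂.le)
      exact h₂.1.ne (first_edge_eq h2 ht)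
    | succ k =>
      exact ⟨k, fun i hi => h₁ (i + 1) (by omega), h₂, fun i hi => h₃ (i + 1) (by omega),
        fun i hi => h₄ (i + 1) (by omega)⟩

theorem vershik_of_isMax (hS : S.toDiagram.ProperlyOrdered) (h2 : S.H2) {z : S.X} {p : ℕ}
    (h : ∀ i < p, IsMax (edge z i)) :
    ∀ i < p, IsMin (edge (OrderedBratteliDiagram.vershik hS z) i) := by
  rcases vershik_spec hS h2 z with ⟨-, h'⟩ | ⟨k, h₁, h₂, h₃, h₄⟩
  · exact fun i _ => h' i
  · have : p ≤ k := by
      by_contra hlt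
      exact (h k (by omega)).not_lt h₂.1
    exact fun i hi => h₃ i (by omega)

theorem vershik_of_not_isMax (hS : S.toDiagram.ProperlyOrdered) (h2 : S.H2) {z : S.X} {p : ℕ}
    (h : ∀ i < p, IsMax (edge z i)) (hp : ¬ IsMax (edge z p)) :
    edge z p ⋖ edge (OrderedBratteliDiagram.vershik hS z) p ∧
      ∀ i, p < i → edge (OrderedBratteliDiagram.vershik hS z) i = edge z i := by
  rcases vershik_spec hS h2 z with ⟨h', -⟩ | ⟨k, h₁, h₂, h₃, h₄⟩
  · exact absurd (h' p) hp
  · have : k = p := by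
      rcases lt_trichotomy k p with hk | hk | hk
      · exact absurd h₂.1 (h k hk).not_lt
      · exact hk
      · exact absurd (h₁ p hk) hp
    subst this
    exact ⟨h₂, h₄⟩

/-! ### Heights and ranks -/

variable (S) in
open Classical in
/-- `hgt S p i` is the number of paths from the root to `i ∈ V_{p+1}`. -/
noncomputable def hgt : ℕ → Fin m → ℕ
  | 0, _ => 1
  | p + 1, j => ∑ e : S.E with S.t e = j, hgt p (S.s e)

open Classical in
/-- The rank of the initial segment of `z` of length `p + 1` among the paths with the same end. -/
noncomputable def rank : ℕ → S.X → ℕ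
  | 0, _ => 0
  | p + 1, z => rank p z + ∑ e : S.E with e < edge z p, hgt S p (S.s e)

theorem hgt_pos (p : ℕ) (i : Fin m) : 0 < hgt S p i := by
  classical
  induction p generalizing i with
  | zero => simp [hgt]
  | succ p ih =>
    obtain ⟨e, he⟩ := S.t_surj i
    rw [hgt]
    exact Finset.sum_pos (fun e _ => ih _) ⟨e, by simp [he]⟩

open Classical in
theorem sum_lt_add_le (w : S.E → ℕ) {e f : S.E} (h : e < f) :
    ∑ g : S.E with g < e, w g + w e ≤ ∑ g : S.E with g < f, w g := by
  have h1 : e ∉ ({g : S.E | g < e} : Finset S.E) := by simp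
  rw [add_comm, ← Finset.sum_insert h1]
  apply Finset.sum_le_sum_of_subset
  intro g hg
  simp only [Finset.mem_insert, Finset.mem_filter, Finset.mem_univ, true_and] at hg ⊢
  rcases hg with rfl | hg
  · exact h
  · exact hg.trans h

open Classical in
theorem sum_lt_of_covBy (w : S.E → ℕ) {e f : S.E} (h : e ⋖ f) :
    ∑ g : S.E with g < f, w g = ∑ g : S.E with g < e, w g + w e := by
  have h1 : e ∉ ({g : S.E | g < e} : Finset S.E) := by simp
  rw [add_comm, ← Finset.sum_insert h1]
  apply Finset.sum_congr _ fun _ _ => rfl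
  ext g
  simp only [Finset.mem_insert, Finset.mem_filter, Finset.mem_univ, true_and]
  constructor
  · intro hg
    exact (le_of_lt_of_covBy h hg).eq_or_lt
  · rintro (rfl | hg)
    · exact h.1
    · exact hg.trans h.1

open Classical in
theorem sum_lt_add_le_sum_target (w : S.E → ℕ) (e : S.E) :
    ∑ g : S.E with g < e, w g + w e ≤ ∑ g : S.E with S.t g = S.t e, w g := by
  have h1 : e ∉ ({g : S.E | g < e} : Finset S.E) := by simp
  rw [add_comm, ← Finset.sum_insert h1]
  apply Finset.sum_le_sum_of_subset
  intro g hg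
  simp only [Finset.mem_insert, Finset.mem_filter, Finset.mem_univ, true_and] at hg ⊢
  rcases hg with rfl | hg
  · rfl
  · exact target_eq_of_le hg.le

open Classical in
theorem sum_lt_add_of_isMax (w : S.E → ℕ) {e : S.E} (h : IsMax e) :
    ∑ g : S.E with g < e, w g + w e = ∑ g : S.E with S.t g = S.t e, w g := by
  have h1 : e ∉ ({g : S.E | g < e} : Finset S.E) := by simp
  rw [add_comm, ← Finset.sum_insert h1]
  apply Finset.sum_congr _ fun _ _ => rfl
  ext g
  simp only [Finset.mem_insert, Finset.mem_filter, Finset.mem_univ, true_and]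
  constructor
  · rintro (rfl | hg)
    · rfl
    · exact target_eq_of_le hg.le
  · intro hg
    exact (le_of_isMax h hg).eq_or_lt

open Classical in
/-- The expansion of an integer with respect to the partial sums of `w` over the edges with a given
terminal vertex is unique. -/
theorem eq_of_sum_lt_add_eq (w : S.E → ℕ) {e f : S.E} (ht : S.t e = S.t f) {a b : ℕ}
    (ha : a < w e) (hb : b < w f)
    (h : a + ∑ g : S.E with g < e, w g = b + ∑ g : S.E with g < f, w g) : e = f ∧ a = b := by
  have hef : e = f := by
    rcases le_or_lt_of_target_eq ht with h' | h'
    · rcases h'.eq_or_lt with h'' | h''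
      · exact h''
      · have := sum_lt_add_le w h''
        omega
    · have := sum_lt_add_le w h'
      omega
  subst hef
  exact ⟨rfl, by omega⟩

theorem rank_lt (p : ℕ) (z : S.X) : rank p z < hgt S p (term z p) := by
  classical
  induction p with
  | zero => simp [rank, hgt]
  | succ p ih =>
    rw [rank, hgt, term_succ]
    have := sum_lt_add_le_sum_target (fun e => hgt S p (S.s e)) (edge z p)
    rw [term_eq_source] at ih
    omega

theorem rank_eq_zero_of_isMin {p : ℕ} {z : S.X} (h : ∀ i < p, IsMin (edge z i)) : rank p z = 0 := by
  classical
  induction p with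
  | zero => rfl
  | succ p ih =>
    rw [rank, ih fun i hi => h i (by omega), Finset.sum_eq_zero, add_zero]
    intro e he
    exact absurd (by simpa using he) (h p (by omega)).not_lt

theorem isMin_of_rank_eq_zero {p : ℕ} {z : S.X} (h : rank p z = 0) : ∀ i < p, IsMin (edge z i) := by
  classical
  induction p with
  | zero => simp
  | succ p ih =>
    rw [rank, Nat.add_eq_zero_iff] at h
    intro i hi
    rcases Nat.lt_succ_iff_lt_or_eq.1 hi with h' | rfl
    · exact ih h.1 i h'
    · rw [isMin_iff_forall_not_lt]
      intro e he
      have := Finset.sum_eq_zero_iff.1 h.2 e (by simpa using he)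
      exact (hgt_pos i (S.s e)).ne' this

theorem rank_of_isMax {p : ℕ} {z : S.X} (h : ∀ i < p, IsMax (edge z i)) :
    rank p z + 1 = hgt S p (term z p) := by
  classical
  induction p with
  | zero => rfl
  | succ p ih =>
    have h1 := ih fun i hi => h i (by omega)
    have h2 := sum_lt_add_of_isMax (fun e => hgt S p (S.s e)) (h p (by omega))
    rw [term_eq_source] at h1
    rw [rank, hgt, term_succ]
    omega

/-- Adding one in mixed radix: a carry that stops below p leaves every later digit alone. If it
stops at the top digit, the maximal block below had rank one less than its height and is traded for
one step of that digit. -/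
theorem vershik_of_exists_not_isMax (hS : S.toDiagram.ProperlyOrdered) (h2 : S.H2) {z : S.X} {p : ℕ}
    (h : ∃ i < p, ¬ IsMax (edge z i)) :
    rank p (OrderedBratteliDiagram.vershik hS z) = rank p z + 1 ∧
      (∀ i, p ≤ i → edge (OrderedBratteliDiagram.vershik hS z) i = edge z i) := by
  classical
  induction p with
  | zero => simp at h
  | succ p ih =>
    by_cases hp : ∃ i < p, ¬ IsMax (edge z i)
    · obtain ⟨h3, h4⟩ := ih hp
      refine ⟨?_, fun i hi => h4 i (by omega)⟩
      rw [rank, rank, h3, h4 p le_rfl]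
      omega
    · push Not at hp
      have hmax : ¬ IsMax (edge z p) := by
        obtain ⟨i, hi, hi'⟩ := h
        rcases Nat.lt_succ_iff_lt_or_eq.1 hi with h' | rfl
        · exact absurd (hp i h') hi'
        · exact hi'
      obtain ⟨h3, h4⟩ := vershik_of_not_isMax hS h2 hp hmax
      refine ⟨?_, fun i hi => h4 i (by omega)⟩
      rw [rank, rank, rank_eq_zero_of_isMin (vershik_of_isMax hS h2 hp), sum_lt_of_covBy _ h3]
      have := rank_of_isMax hp
      rw [term_eq_source] at this
      omega

theorem isMax_of_rank {hS : S.toDiagram.ProperlyOrdered} {h2 : S.H2} {p : ℕ} {z : S.X}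
    (h : rank p z + 1 = hgt S p (term z p)) : ∀ i < p, IsMax (edge z i) := by
  by_contra! h'
  obtain ⟨h3, h4⟩ := vershik_of_exists_not_isMax hS h2 h'
  have := rank_lt p (OrderedBratteliDiagram.vershik hS z)
  rw [term_eq_source, h4 p le_rfl, ← term_eq_source] at this
  omega

/-- The digits are recovered from the top: uniqueness of the expansion gives the last edge, whose
source is the terminal vertex needed for the remaining ones. -/
theorem edge_eq_of_rank_eq {p : ℕ} {z w : S.X} (ht : term z p = term w p) (h : rank p z = rank p w) :
    ∀ i < p, edge z i = edge w i := by
  classical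
  induction p with
  | zero => simp
  | succ p ih =>
    rw [rank, rank] at h
    have h1 := rank_lt p z
    have h2 := rank_lt p w
    rw [term_eq_source] at h1 h2
    obtain ⟨h3, h4⟩ := eq_of_sum_lt_add_eq (fun e => hgt S p (S.s e)) ht h1 h2 h
    intro i hi
    rcases Nat.lt_succ_iff_lt_or_eq.1 hi with h' | rfl
    · exact ih (by rw [term_eq_source, term_eq_source]; exact congrArg S.s h3) h4 i h'
    · exact h3

theorem rank_congr {p : ℕ} {z w : S.X} (h : ∀ i < p, edge z i = edge w i) : rank p z = rank p w := by
  classical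
  induction p with
  | zero => rfl
  | succ p ih => rw [rank, rank, ih fun i hi => h i (by omega), h p (by omega)]

/-- This converts cylinders into levels of towers; (H2) recovers the root edge from the vertex it
reaches. -/
theorem mem_cyl_iff (h2 : S.H2) {x z : S.X} {p : ℕ} :
    z ∈ OrderedBratteliDiagram.cyl x (p + 1) ↔ term z p = term x p ∧ rank p z = rank p x := by
  constructor
  · intro h
    refine ⟨congrArg (S.toDiagram.t p) (h p (by omega)), rank_congr fun i hi => h (i + 1) (by omega)⟩
  · rintro ⟨h, h'⟩ i hi
    have h'' := edge_eq_of_rank_eq h h'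
    cases i with
    | zero =>
      apply first_edge_eq h2
      cases p with
      | zero => exact h
      | succ p => rw [term_eq_source, term_eq_source, h'' 0 (by omega)]
    | succ i => exact h'' i (by omega)

theorem mem_minCyl_iff (h2 : S.H2) {z : S.X} {p : ℕ} {i : Fin m} :
    z ∈ minCyl p i ↔ term z p = i ∧ rank p z = 0 := by
  constructor
  · rintro ⟨h, h'⟩
    exact ⟨h', rank_eq_zero_of_isMin fun i hi => h (i + 1) (by omega)⟩
  · rintro ⟨h, h'⟩
    refine ⟨fun q hq => ?_, h⟩
    cases q with
    | zero => exact isMin_first_edge h2 z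
    | succ q => exact isMin_of_rank_eq_zero h' q (by omega)

theorem vershik_of_rank_lt {hS : S.toDiagram.ProperlyOrdered} (h2 : S.H2) {p : ℕ} {z : S.X}
    (h : rank p z + 1 < hgt S p (term z p)) :
    rank p (OrderedBratteliDiagram.vershik hS z) = rank p z + 1 ∧
      tail h2 p (OrderedBratteliDiagram.vershik hS z) = tail h2 p z := by
  have h' : ∃ i < p, ¬ IsMax (edge z i) := by
    by_contra! h'
    have := rank_of_isMax h'
    omega
  obtain ⟨h3, h4⟩ := vershik_of_exists_not_isMax hS h2 h'
  exact ⟨h3, path_ext h2 fun k => h4 (p + k) (by omega)⟩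

/-- Forgetting an initial segment of maximal edges commutes with the Vershik map. -/
theorem tail_vershik_of_isMax (hS : S.toDiagram.ProperlyOrdered) (h2 : S.H2) {z : S.X} {p : ℕ}
    (h : ∀ i < p, IsMax (edge z i)) :
    tail h2 p (OrderedBratteliDiagram.vershik hS z) =
      OrderedBratteliDiagram.vershik hS (tail h2 p z) := by
  rcases vershik_spec hS h2 z with ⟨h', h''⟩ | ⟨k, h₁, h₂, h₃, h₄⟩
  -- For the maximal path both sides consist of minimal edges, and the minimal path is unique.
  · have hmin : ∀ w : S.X, (∀ k, IsMin (edge w k)) → OrderedBratteliDiagram.AllMin w := by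
      intro w hw n
      cases n with
      | zero => exact isMin_first_edge h2 w
      | succ n => exact hw n
    refine hS.2.unique (hmin _ fun k => h'' (p + k)) (hmin _ fun k => ?_)
    exact vershik_of_isMax hS h2 (p := k + 1) (fun i _ => h' (p + i)) k (by omega)
  -- The carry runs through the first p edges and stops at some p + a, so the tail sees a carry that
  -- stops at a.
  · have hpk : p ≤ k := by
      by_contra hlt
      exact (h k (by omega)).not_lt h₂.1
    obtain ⟨a, rfl⟩ := Nat.exists_eq_add_of_le hpk
    have hm : ∀ i < a, IsMax (edge (tail h2 p z) i) := fun i hi => h₁ (p + i) (by omega)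
    have hm' : ¬ IsMax (edge (tail h2 p z) a) := fun hmax => hmax.not_lt h₂.1
    obtain ⟨h₅, h₆⟩ := vershik_of_not_isMax hS h2 hm hm'
    have ha := covBy_unique h₂ h₅
    have hlow := edge_eq_of_rank_eq (p := a)
      (z := tail h2 p (OrderedBratteliDiagram.vershik hS z))
      (w := OrderedBratteliDiagram.vershik hS (tail h2 p z))
      (by rw [term_eq_source, term_eq_source, edge_tail, ha])
      (by rw [rank_eq_zero_of_isMin (vershik_of_isMax hS h2 hm),
            rank_eq_zero_of_isMin fun i hi => h₃ (p + i) (by omega)])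
    refine path_ext h2 fun i => ?_
    rcases lt_trichotomy i a with hi | rfl | hi
    · exact hlow i hi
    · exact ha
    · rw [h₆ i hi]
      exact h₄ (p + i) (by omega)

theorem vershik_of_rank_eq {hS : S.toDiagram.ProperlyOrdered} (h2 : S.H2) {p : ℕ} {z : S.X}
    (h : rank p z + 1 = hgt S p (term z p)) :
    rank p (OrderedBratteliDiagram.vershik hS z) = 0 ∧
      tail h2 p (OrderedBratteliDiagram.vershik hS z) =
        OrderedBratteliDiagram.vershik hS (tail h2 p z) := by
  have h' := isMax_of_rank (hS := hS) (h2 := h2) h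
  exact ⟨rank_eq_zero_of_isMin (vershik_of_isMax hS h2 h'), tail_vershik_of_isMax hS h2 h'⟩

end StationaryDiagram

/-! ### Entrance times -/

section EntranceTime

variable {X : Type*} {T : X → X} {I : Set X}

/-- Recurrence at every point keeps the defining infimum away from the empty set, where `sInf` would
return 0. -/
theorem entranceTime_succ_spec (hI : ∀ x, ∃ n, 0 < n ∧ T^[n] x ∈ I) (k : ℕ) (x : X) :
    entranceTime T I k x < entranceTime T I (k + 1) x ∧ T^[entranceTime T I (k + 1) x] x ∈ I := by
  have hne : {n | entranceTime T I k x < n ∧ T^[n] x ∈ I}.Nonempty := by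
    obtain ⟨n, hn, hn'⟩ := hI (T^[entranceTime T I k x] x)
    exact ⟨n + entranceTime T I k x, by omega, by rwa [Function.iterate_add_apply]⟩
  exact Nat.sInf_mem hne

theorem entranceTime_succ_le {k n : ℕ} {x : X} (h : entranceTime T I k x < n) (hn : T^[n] x ∈ I) :
    entranceTime T I (k + 1) x ≤ n :=
  Nat.sInf_le ⟨h, hn⟩

theorem entranceTime_succ_eq {k n : ℕ} {x : X} (h : entranceTime T I k x < n) (hn : T^[n] x ∈ I)
    (h' : ∀ q, entranceTime T I k x < q → T^[q] x ∈ I → n ≤ q) : entranceTime T I (k + 1) x = n :=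
  le_antisymm (entranceTime_succ_le h hn) (le_csInf ⟨n, h, hn⟩ fun q hq => h' q hq.1 hq.2)

theorem entranceTime_succ (hI : ∀ x, ∃ n, 0 < n ∧ T^[n] x ∈ I) (k : ℕ) (x : X) :
    entranceTime T I (k + 1) x =
      entranceTime T I k x + entranceTime T I 1 (T^[entranceTime T I k x] x) := by
  obtain ⟨h1, h2⟩ := entranceTime_succ_spec hI 0 (T^[entranceTime T I k x] x)
  rw [← Function.iterate_add_apply, zero_add, add_comm] at h2
  refine entranceTime_succ_eq ?_ h2 ?_
  · simp only [zero_add] at h1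
    change 0 < _ at h1
    omega
  · intro q hq hq'
    obtain ⟨a, rfl⟩ := Nat.exists_eq_add_of_lt hq
    rw [add_assoc, add_comm, Function.iterate_add_apply] at hq'
    have : entranceTime T I (0 + 1) (T^[entranceTime T I k x] x) ≤ a + 1 :=
      entranceTime_succ_le (Nat.succ_pos a) hq'
    rw [zero_add] at this
    omega

/-- Splitting off the first entrance, rather than the last, makes a later gap of x an earlier gap of
the first entrance point. -/
theorem entranceTime_succ' (hI : ∀ x, ∃ n, 0 < n ∧ T^[n] x ∈ I) (k : ℕ) (x : X) :
    entranceTime T I (k + 1) x =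
      entranceTime T I 1 x + entranceTime T I k (T^[entranceTime T I 1 x] x) := by
  induction k with
  | zero => rfl
  | succ k ih =>
    rw [entranceTime_succ hI (k + 1), ih, entranceTime_succ hI k, add_assoc,
      ← Function.iterate_add_apply, add_comm (entranceTime T I 1 x) (entranceTime T I k _)]

theorem entranceTime_one_pos (hrec : ∀ x, ∃ n, 0 < n ∧ T^[n] x ∈ I) (x : X) :
    0 < entranceTime T I 1 x := (entranceTime_succ_spec hrec 0 x).1

theorem entranceTime_one_of_mem {x : X} (h : T x ∈ I) : entranceTime T I 1 x = 1 :=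
  entranceTime_succ_eq (k := 0) Nat.one_pos h fun _ hq _ => hq

theorem entranceTime_one_of_notMem (hrec : ∀ x, ∃ n, 0 < n ∧ T^[n] x ∈ I) {x : X} (h : T x ∉ I) :
    entranceTime T I 1 x = entranceTime T I 1 (T x) + 1 := by
  obtain ⟨h1, h2⟩ := entranceTime_succ_spec hrec 0 (T x)
  refine entranceTime_succ_eq (k := 0) (Nat.succ_pos _) h2 fun q hq hq' => ?_
  obtain ⟨b, rfl⟩ := Nat.exists_eq_add_of_lt hq
  have hb : 0 < b := by
    rcases Nat.eq_zero_or_pos b with rfl | hb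
    · exact absurd hq' h
    · exact hb
  have hq'' : T^[b] (T x) ∈ I := by
    rw [← Function.iterate_succ_apply T]
    simpa [entranceTime] using hq'
  have : entranceTime T I (0 + 1) (T x) ≤ b := entranceTime_succ_le (k := 0) hb hq''
  change entranceTime T I (0 + 1) (T x) + 1 ≤ 0 + b + 1
  omega

end EntranceTime

/-! ### Suspensions -/

/-- The map `T` is, via `z ↦ (σ z, ρ z)`, a suspension of itself with roof function `H`: a point
moves upwards from the level `ρ z` above `σ z`, until it reaches the roof. -/
structure IsSuspension {X : Type*} (T : X → X) (σ : X → X) (ρ H : X → ℕ) : Prop where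
  pos : ∀ y, 0 < H y
  lt : ∀ z, ρ z < H (σ z)
  up : ∀ z, ρ z + 1 < H (σ z) → ρ (T z) = ρ z + 1 ∧ σ (T z) = σ z
  roof : ∀ z, ρ z + 1 = H (σ z) → ρ (T z) = 0 ∧ σ (T z) = T (σ z)

/-- The Birkhoff sums of `H`. -/
def suspSum {X : Type*} (T : X → X) (H : X → ℕ) (y : X) (n : ℕ) : ℕ :=
  ∑ b ∈ Finset.range n, H (T^[b] y)

namespace IsSuspension

variable {X : Type*} {T : X → X} {σ : X → X} {ρ H : X → ℕ}

theorem suspSum_succ (y : X) (n : ℕ) :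
    suspSum T H y (n + 1) = suspSum T H y n + H (T^[n] y) := Finset.sum_range_succ _ _

theorem suspSum_mono (y : X) : Monotone (suspSum T H y) :=
  monotone_nat_of_le_succ fun n => by rw [suspSum_succ]; omega

theorem eq_of_suspSum_add_eq {y : X} {n k a b : ℕ} (ha : a < H (T^[n] y)) (hb : b < H (T^[k] y))
    (h : suspSum T H y n + a = suspSum T H y k + b) : n = k ∧ a = b := by
  have hnk : n = k := by
    rcases lt_trichotomy n k with h' | h' | h'
    · have := suspSum_mono (T := T) (H := H) y (Nat.succ_le_of_lt h')
      rw [Nat.succ_eq_add_one, suspSum_succ] at this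
      omega
    · exact h'
    · have := suspSum_mono (T := T) (H := H) y (Nat.succ_le_of_lt h')
      rw [Nat.succ_eq_add_one, suspSum_succ] at this
      omega
  subst hnk
  exact ⟨rfl, by omega⟩

/-- Each time step raises completed roofs plus current level by one: at a roof crossing the finished
height moves into `suspSum`. -/
theorem exists_iterate (h : IsSuspension T σ ρ H) (z : X) (q : ℕ) :
    ∃ n, σ (T^[q] z) = T^[n] (σ z) ∧ suspSum T H (σ z) n + ρ (T^[q] z) = ρ z + q := by
  induction q with
  | zero => exact ⟨0, rfl, by simp [suspSum]⟩
  | succ q ih =>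
    obtain ⟨n, h1, h2⟩ := ih
    rw [Function.iterate_succ_apply']
    rcases (Nat.succ_le_of_lt (h.lt (T^[q] z))).lt_or_eq with h' | h'
    · obtain ⟨h3, h4⟩ := h.up _ h'
      exact ⟨n, h4.trans h1, by omega⟩
    · obtain ⟨h3, h4⟩ := h.roof _ h'
      refine ⟨n + 1, ?_, ?_⟩
      · rw [h4, h1, Function.iterate_succ_apply']
      · rw [suspSum_succ, h3, ← h1, ← h']
        omega

theorem iterate_of_eq (h : IsSuspension T σ ρ H) {z : X} {q n a : ℕ} (ha : a < H (T^[n] (σ z)))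
    (hq : suspSum T H (σ z) n + a = ρ z + q) : σ (T^[q] z) = T^[n] (σ z) ∧ ρ (T^[q] z) = a := by
  obtain ⟨k, h1, h2⟩ := h.exists_iterate z q
  have hb := h.lt (T^[q] z)
  rw [h1] at hb
  obtain ⟨rfl, rfl⟩ := eq_of_suspSum_add_eq ha hb (by omega)
  exact ⟨h1, rfl⟩

/-! ### Returns to one level of a suspension -/

variable {C : Set X} {a : ℕ}

theorem suspSum_strictMono (h : IsSuspension T σ ρ H) (z : X) :
    StrictMono (suspSum T H (σ z)) :=
  strictMono_nat_of_lt_succ fun n => by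
    rw [suspSum_succ]
    have := h.pos (T^[n] (σ z))
    omega

/-- A level of the suspension over `C` is recurrent as soon as `C` is. -/
theorem recurrent (h : IsSuspension T σ ρ H) (hC : ∀ y, ∃ n, 0 < n ∧ T^[n] y ∈ C)
    (ha : ∀ y ∈ C, a < H y) (z : X) : ∃ n, 0 < n ∧ T^[n] z ∈ {w | σ w ∈ C ∧ ρ w = a} := by
  obtain ⟨n, hn, hnC⟩ := hC (σ z)
  have h1 : suspSum T H (σ z) 1 ≤ suspSum T H (σ z) n := suspSum_mono _ hn
  have h2 := h.lt z
  simp only [suspSum, Finset.sum_range_one, Function.iterate_zero, id_eq] at h1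
  obtain ⟨q, hq⟩ := Nat.exists_eq_add_of_lt (show ρ z < suspSum T H (σ z) n by unfold suspSum; omega)
  obtain ⟨h3, h4⟩ := h.iterate_of_eq (q := q + 1 + a) (ha _ hnC) (by omega)
  exact ⟨q + 1 + a, by omega, by rw [h3]; exact hnC, h4⟩

/-- Start and target lie on the same level a, so the two offsets cancel and the elapsed time is a
Birkhoff sum of the roof. -/
theorem entranceTime_eq (h : IsSuspension T σ ρ H) (hC : ∀ y, ∃ n, 0 < n ∧ T^[n] y ∈ C)
    (ha : ∀ y ∈ C, a < H y) {z : X} (hz : ρ z = a) (k : ℕ) :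
    entranceTime T {w | σ w ∈ C ∧ ρ w = a} k z =
      suspSum T H (σ z) (entranceTime T C k (σ z)) := by
  induction k with
  | zero => simp [entranceTime, suspSum]
  | succ k ih =>
    obtain ⟨h1, h2⟩ := entranceTime_succ_spec hC k (σ z)
    refine entranceTime_succ_eq (by rw [ih]; exact h.suspSum_strictMono z h1) ?_ ?_
    · obtain ⟨h3, h4⟩ := h.iterate_of_eq (z := z) (q := suspSum T H (σ z)
        (entranceTime T C (k + 1) (σ z))) (ha _ h2) (by omega)
      exact ⟨by rw [h3]; exact h2, h4⟩
    · rintro q hq ⟨hq1, hq2⟩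
      obtain ⟨n, h3, h4⟩ := h.exists_iterate z q
      have : q = suspSum T H (σ z) n := by omega
      rw [this]
      rw [ih, this, (h.suspSum_strictMono z).lt_iff_lt] at hq
      rw [h3] at hq1
      exact suspSum_mono _ (entranceTime_succ_le hq hq1)

theorem iterate_entranceTime (h : IsSuspension T σ ρ H) (hC : ∀ y, ∃ n, 0 < n ∧ T^[n] y ∈ C)
    (ha : ∀ y ∈ C, a < H y) {z : X} (hzC : σ z ∈ C) (hz : ρ z = a) (k : ℕ) :
    σ (T^[entranceTime T {w | σ w ∈ C ∧ ρ w = a} k z] z) =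
      T^[entranceTime T C k (σ z)] (σ z) ∧
    ρ (T^[entranceTime T {w | σ w ∈ C ∧ ρ w = a} k z] z) = a := by
  have hmem : T^[entranceTime T C k (σ z)] (σ z) ∈ C := by
    cases k with
    | zero => exact hzC
    | succ k => exact (entranceTime_succ_spec hC k _).2
  rw [h.entranceTime_eq hC ha hz]
  exact h.iterate_of_eq (ha _ hmem) (by omega)

/-- The visits to the basis of the suspension above `D` during an excursion from a level above `C`
correspond to the visits to `D` during an excursion from `C`. -/
theorem ncard_visits (h : IsSuspension T σ ρ H) (hC : ∀ y, ∃ n, 0 < n ∧ T^[n] y ∈ C)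
    (ha : ∀ y ∈ C, a < H y) {z : X} (hzC : σ z ∈ C) (hz : ρ z = a) {D : Set X}
    (hD : ∀ y ∈ C, ∀ y' ∈ C, y ∈ D → y' ∈ D) :
    Set.ncard {q | q < entranceTime T {w | σ w ∈ C ∧ ρ w = a} 1 z ∧
      T^[q] z ∈ {w | σ w ∈ D ∧ ρ w = 0}} =
    Set.ncard {n | n < entranceTime T C 1 (σ z) ∧ T^[n] (σ z) ∈ D} := by
  rw [h.entranceTime_eq hC ha hz]
  obtain ⟨h0, hN⟩ := entranceTime_succ_spec hC 0 (σ z)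
  rw [zero_add] at h0 hN
  change 0 < _ at h0
  set N := entranceTime T C 1 (σ z)
  have hmono := h.suspSum_strictMono z
  have hH0 := ha _ hzC
  have hHN := ha _ hN
  have hone : ∀ n, 0 < n → H (σ z) ≤ suspSum T H (σ z) n := by
    intro n hn
    have h1 : suspSum T H (σ z) 1 ≤ suspSum T H (σ z) n := suspSum_mono _ hn
    simpa [suspSum] using h1
  symm
  -- If a > 0, the basis below z was passed before time 0, while the basis below the return point is
  -- passed a steps before the end. By `hD` the latter visit replaces the missing one of index 0.
  refine Set.ncard_congr (fun n _ => if n = 0 ∧ 0 < a then suspSum T H (σ z) N - a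
    else suspSum T H (σ z) n - a) ?_ ?_ ?_
  · rintro n ⟨hn, hnD⟩
    have hlt := hmono hn
    split_ifs with hc
    · obtain ⟨rfl, hapos⟩ := hc
      have := hone N h0
      obtain ⟨h3, h4⟩ := h.iterate_of_eq (z := z) (n := N) (a := 0)
        (q := suspSum T H (σ z) N - a) (h.pos _) (by omega)
      exact ⟨by omega, by rw [h3]; exact hD _ hzC _ hN hnD, h4⟩
    · have hle : a ≤ suspSum T H (σ z) n := by
        rcases Nat.eq_zero_or_pos n with rfl | hpos
        · have : ¬ 0 < a := fun h' => hc ⟨rfl, h'⟩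
          omega
        · have := hone n hpos
          omega
      obtain ⟨h3, h4⟩ := h.iterate_of_eq (z := z) (n := n) (a := 0)
        (q := suspSum T H (σ z) n - a) (h.pos (T^[n] (σ z))) (by omega)
      exact ⟨by omega, by rw [h3]; exact hnD, h4⟩
  · rintro n n' ⟨hn, -⟩ ⟨hn', -⟩ heq
    have hlt := hmono hn
    have hlt' := hmono hn'
    have hNa := hone N h0
    have hna := hone n
    have hna' := hone n'
    apply hmono.injective
    split_ifs at heq with hc hc' hc'
    · rw [hc.1, hc'.1]
    · by_cases hz' : n' = 0
      · exact absurd ⟨hz', hc.2⟩ hc'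
      · have := hna' (by omega)
        omega
    · by_cases hz' : n = 0
      · exact absurd ⟨hz', hc'.2⟩ hc
      · have := hna (by omega)
        omega
    · by_cases hapos : 0 < a
      · have h5 := hna (Nat.pos_of_ne_zero fun h' => hc ⟨h', hapos⟩)
        have h6 := hna' (Nat.pos_of_ne_zero fun h' => hc' ⟨h', hapos⟩)
        omega
      · omega
  · rintro q ⟨hq, hqD, hq0⟩
    obtain ⟨n, h3, h4⟩ := h.exists_iterate z q
    rw [hq0, hz] at h4
    rw [h3] at hqD
    rcases lt_trichotomy n N with hn | rfl | hn
    · refine ⟨n, ⟨hn, hqD⟩, ?_⟩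
      have hc : ¬ (n = 0 ∧ 0 < a) := by
        rintro ⟨rfl, hapos⟩
        simp [suspSum] at h4
        omega
      rw [if_neg hc]
      omega
    · refine ⟨0, ⟨h0, hD _ hN _ hzC hqD⟩, ?_⟩
      rw [if_pos ⟨rfl, by omega⟩]
      omega
    · exfalso
      have := suspSum_mono (T := T) (H := H) (σ z) (Nat.succ_le_of_lt hn)
      rw [Nat.succ_eq_add_one, suspSum_succ] at this
      omega

end IsSuspension

namespace StationaryDiagram

open OrderedBratteliDiagram

variable {m : ℕ} {S : StationaryDiagram m}

/-! ### The towers of a stationary diagram -/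

/-- The basis and the map on it do not depend on p; only the roof does. Facts about `startSet v`
thus transfer to cylinders of every length. -/
theorem isSuspension_tail (hS : S.toDiagram.ProperlyOrdered) (h2 : S.H2) (p : ℕ) :
    IsSuspension (vershik hS) (tail h2 p) (rank p) (fun y => hgt S p (term y 0)) where
  pos y := hgt_pos p _
  lt z := by
    rw [term_tail]
    exact rank_lt p z
  up z h := by
    rw [term_tail] at h
    exact vershik_of_rank_lt h2 h
  roof z h := by
    rw [term_tail] at h
    exact vershik_of_rank_eq h2 h

variable (S) in
/-- The paths whose first edge ends at `v`. -/
def startSet (v : Fin m) : Set S.X := {y | term y 0 = v}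

theorem mem_startSet {v : Fin m} {y : S.X} : y ∈ S.startSet v ↔ term y 0 = v := Iff.rfl

theorem exists_edge (h1 : S.H1) (i j : Fin m) : ∃ e : S.E, S.s e = i ∧ S.t e = j := by
  have h := h1 i j
  rw [M, Nat.cast_pos, Nat.card_pos_iff] at h
  obtain ⟨⟨e, he⟩⟩ := h.1
  exact ⟨e, he⟩

/-- After the current tower of level p = 1 comes a complete one, over the Vershik image of the tail.
Climbing it runs through all edges into one vertex, and by (H1) one of them starts at v. -/
theorem startSet_recurrent (hS : S.toDiagram.ProperlyOrdered) (h1 : S.H1) (h2 : S.H2) (v : Fin m)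
    (y : S.X) : ∃ n, 0 < n ∧ (vershik hS)^[n] y ∈ S.startSet v := by
  classical
  have hs := isSuspension_tail hS h2 1
  obtain ⟨e, he, het⟩ := exists_edge h1 v (term (vershik hS (tail h2 1 y)) 0)
  -- The rank at which the edge e is reached in that tower.
  set a := ∑ g : S.E with g < e, hgt S 0 (S.s g) with ha
  have hlt : a < hgt S 1 (term (vershik hS (tail h2 1 y)) 0) := by
    have := sum_lt_add_le_sum_target (fun g => hgt S 0 (S.s g)) e
    have := hgt_pos (S := S) 0 (S.s e)
    rw [hgt, ← het]
    omega
  have hr := hs.lt y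
  obtain ⟨q, hq⟩ := Nat.exists_eq_add_of_lt (show rank 1 y < hgt S 1 (term (tail h2 1 y) 0) + a by
    omega)
  obtain ⟨h3, h4⟩ := hs.iterate_of_eq (z := y) (n := 1) (a := a) (q := q + 1) hlt (by
    simp only [suspSum, Finset.sum_range_one, Function.iterate_zero, id_eq]
    omega)
  refine ⟨q + 1, Nat.succ_pos q, ?_⟩
  have ht : term ((vershik hS)^[q + 1] y) 1 = S.t e := by
    rw [het, ← Function.iterate_one (vershik hS), ← h3, term_tail, Function.iterate_one]
  have hedge := (eq_of_sum_lt_add_eq (fun g => hgt S 0 (S.s g))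
    (e := edge ((vershik hS)^[q + 1] y) 0) (f := e) (a := 0) (b := 0) ht
    (hgt_pos _ _) (hgt_pos _ _) (by rw [← ha, ← h4, rank, rank, zero_add, zero_add])).1
  rw [mem_startSet, term_eq_source, hedge, he]

theorem cyl_eq (h2 : S.H2) {v : Fin m} {p : ℕ} {x : S.X} (hx : term x p = v) :
    cyl x (p + 1) = {w | tail h2 p w ∈ S.startSet v ∧ rank p w = rank p x} := by
  ext w
  rw [mem_cyl_iff h2, hx]
  exact and_congr_left fun _ => by rw [mem_startSet, term_tail, add_zero]

theorem minCyl_eq (h2 : S.H2) (p : ℕ) (i : Fin m) :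
    (minCyl p i : Set S.X) = {w | tail h2 p w ∈ S.startSet i ∧ rank p w = 0} := by
  ext w
  rw [mem_minCyl_iff h2]
  exact and_congr_left fun _ => by rw [mem_startSet, term_tail, add_zero]

theorem rank_lt_of_mem_startSet {v : Fin m} {p : ℕ} {x : S.X} (hx : term x p = v) :
    ∀ y ∈ S.startSet v, rank p x < hgt S p (term y 0) := by
  intro y hy
  rw [mem_startSet.1 hy, ← hx]
  exact rank_lt p x

theorem cyl_recurrent (hS : S.toDiagram.ProperlyOrdered) (h1 : S.H1) (h2 : S.H2) (x : S.X) (p : ℕ)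
    (z : S.X) : ∃ n, 0 < n ∧ (vershik hS)^[n] z ∈ cyl x (p + 1) := by
  rw [cyl_eq h2 rfl]
  exact (isSuspension_tail hS h2 p).recurrent (startSet_recurrent hS h1 h2 _)
    (rank_lt_of_mem_startSet rfl) z

/-! ### The first edges of a path determine its returns -/

/-- The paths `y` and `z` have the same first `p` stationary edges. -/
def Agree (p : ℕ) (y z : S.X) : Prop := ∀ i < p, edge y i = edge z i

theorem Agree.mono {p q : ℕ} {y z : S.X} (h : Agree q y z) (hpq : p ≤ q) : Agree p y z :=
  fun i hi => h i (by omega)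

theorem Agree.term_eq {p : ℕ} {y z : S.X} (h : Agree p y z) {i : ℕ} (hi : i < p) :
    term y i = term z i := by
  rw [term_eq_source, term_eq_source, h i hi]

theorem Agree.vershik_of_not_isMax {hS : S.toDiagram.ProperlyOrdered} (h2 : S.H2) {p : ℕ}
    {y z : S.X} (h : Agree p y z) (hmax : ∃ i < p, ¬ IsMax (edge y i)) :
    Agree p (vershik hS y) (vershik hS z) := by
  have hmax' : ∃ i < p, ¬ IsMax (edge z i) := by
    obtain ⟨i, hi, hi'⟩ := hmax
    exact ⟨i, hi, by rwa [← h i hi]⟩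
  obtain ⟨h3, h4⟩ := vershik_of_exists_not_isMax hS h2 hmax
  obtain ⟨h3', h4'⟩ := vershik_of_exists_not_isMax hS h2 hmax'
  refine edge_eq_of_rank_eq ?_ (by rw [h3, h3', rank_congr h])
  rw [term_eq_source, term_eq_source, h4 p le_rfl, h4' p le_rfl]
  obtain ⟨i, hi, -⟩ := hmax
  obtain ⟨q, rfl⟩ := Nat.exists_eq_add_of_lt (Nat.zero_lt_of_lt hi)
  rw [← target_edge, ← target_edge, h _ (by omega)]

/-- A carry into the unknown edges costs one edge of agreement: the edge p becomes minimal, (H3)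
fixes its source, and that vertex determines the minimal edges before it. -/
theorem Agree.vershik_of_isMax [NeZero m] {hS : S.toDiagram.ProperlyOrdered} (h2 : S.H2) (h3 : S.H3)
    {p : ℕ} {y z : S.X} (h : Agree (p + 1) y z) (hmax : ∀ i < p + 1, IsMax (edge y i)) :
    Agree p (vershik hS y) (vershik hS z) := by
  have hmax' : ∀ i < p + 1, IsMax (edge z i) := fun i hi => h i hi ▸ hmax i hi
  have hy := StationaryDiagram.vershik_of_isMax hS h2 hmax
  have hz := StationaryDiagram.vershik_of_isMax hS h2 hmax'
  refine edge_eq_of_rank_eq ?_ ?_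
  · rw [term_eq_source, term_eq_source, h3 _ (hy p (by omega)), h3 _ (hz p (by omega))]
  · rw [rank_eq_zero_of_isMin fun i hi => hy i (by omega),
      rank_eq_zero_of_isMin fun i hi => hz i (by omega)]

variable [NeZero m] {hS : S.toDiagram.ProperlyOrdered}

/-- At most one carry goes beyond the known edges before the return to `startSet v`. After it the
first edge restarts from a minimal one, and by (H1) it cannot become maximal without passing an edge
from v, which would be the return. -/
theorem Agree.iterate (h1 : S.H1) (h2 : S.H2) (h3 : S.H3) {v : Fin m} {p : ℕ} (hp : 1 ≤ p)
    {y z : S.X} (h : Agree (p + 1) y z) {n : ℕ}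
    (hn : n ≤ entranceTime (vershik hS) (S.startSet v) 1 y) :
    Agree p ((vershik hS)^[n] y) ((vershik hS)^[n] z) := by
  have hnot : ∀ n, 0 < n → n < entranceTime (vershik hS) (S.startSet v) 1 y →
      S.s (edge ((vershik hS)^[n] y) 0) ≠ v := by
    intro n hn hn' hv
    rw [← term_eq_source, ← mem_startSet] at hv
    exact absurd (entranceTime_succ_le (k := 0) hn hv) (not_le_of_gt hn')
  -- The alternatives are the phases before and after the carry; the second records that the current
  -- first edge and all smaller ones avoid v.
  suffices key : ∀ n ≤ entranceTime (vershik hS) (S.startSet v) 1 y,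
      Agree p ((vershik hS)^[n] y) ((vershik hS)^[n] z) ∧
      (n < entranceTime (vershik hS) (S.startSet v) 1 y →
        Agree (p + 1) ((vershik hS)^[n] y) ((vershik hS)^[n] z) ∨
        ∀ e ≤ edge ((vershik hS)^[n] y) 0, S.s e ≠ v) from (key n hn).1
  intro n
  induction n with
  | zero => exact fun _ => ⟨h.mono (by omega), fun _ => Or.inl h⟩
  | succ n ih =>
    intro hn
    obtain ⟨h4, h5⟩ := ih (by omega)
    have hnext := hnot (n + 1) (Nat.succ_pos n)
    rw [Function.iterate_succ_apply'] at hnext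
    rw [Function.iterate_succ_apply', Function.iterate_succ_apply']
    generalize (vershik hS)^[n] y = y' at *
    generalize (vershik hS)^[n] z = z' at *
    rcases h5 (by omega) with h6 | h6
    · by_cases hmax : ∃ i < p + 1, ¬ IsMax (edge y' i)
      · have := h6.vershik_of_not_isMax (hS := hS) h2 hmax
        exact ⟨this.mono (by omega), fun _ => Or.inl this⟩
      · push Not at hmax
        refine ⟨h6.vershik_of_isMax h2 h3 hmax, fun hlt => Or.inr fun e he => ?_⟩
        have hmin := StationaryDiagram.vershik_of_isMax hS h2 hmax 0 (by omega)
        rw [le_antisymm he (hmin he)]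
        exact hnext hlt
    · have hmax : ¬ IsMax (edge y' 0) := by
        intro hmax
        obtain ⟨e, he, het⟩ := exists_edge h1 v (S.t (edge y' 0))
        exact h6 e (le_of_isMax hmax het) he
      refine ⟨h4.vershik_of_not_isMax h2 ⟨0, by omega, hmax⟩, fun hlt => Or.inr fun e he => ?_⟩
      have hcov := (StationaryDiagram.vershik_of_not_isMax hS h2 (p := 0) (by simp) hmax).1
      rcases he.eq_or_lt with rfl | he'
      · exact hnext hlt
      · exact h6 e (le_of_lt_of_covBy hcov he')

theorem Agree.entranceTime_one (h1 : S.H1) (h2 : S.H2) (h3 : S.H3) {v : Fin m} {p : ℕ} (hp : 1 ≤ p)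
    {y z : S.X} (h : Agree (p + 1) y z) :
    entranceTime (vershik hS) (S.startSet v) 1 y = entranceTime (vershik hS) (S.startSet v) 1 z := by
  obtain ⟨h4, h5⟩ := entranceTime_succ_spec (startSet_recurrent hS h1 h2 v) 0 y
  have hag : ∀ n ≤ entranceTime (vershik hS) (S.startSet v) 1 y,
      ((vershik hS)^[n] y ∈ S.startSet v ↔ (vershik hS)^[n] z ∈ S.startSet v) := by
    intro n hn
    rw [mem_startSet, mem_startSet, (h.iterate h1 h2 h3 hp hn).term_eq (by omega)]
  refine (entranceTime_succ_eq (k := 0) (x := z) h4 ((hag _ le_rfl).1 h5) fun q hq hq' => ?_).symm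
  by_contra hlt
  exact hlt (entranceTime_succ_le hq ((hag q (by rw [zero_add] at hlt; omega)).2 hq'))

/-- Each return costs one edge of agreement, so k + 1 edges determine the two edges found after k -
1 returns. -/
theorem Agree.entranceTime_eq (h1 : S.H1) (h2 : S.H2) (h3 : S.H3) {v : Fin m} (k : ℕ) {p : ℕ}
    (hp : 1 ≤ p) {y z : S.X} (h : Agree (p + k) y z) :
    entranceTime (vershik hS) (S.startSet v) k y = entranceTime (vershik hS) (S.startSet v) k z ∧
    Agree p ((vershik hS)^[entranceTime (vershik hS) (S.startSet v) k y] y)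
      ((vershik hS)^[entranceTime (vershik hS) (S.startSet v) k z] z) := by
  induction k generalizing p with
  | zero => exact ⟨rfl, h⟩
  | succ k ih =>
    obtain ⟨h4, h5⟩ := ih (p := p + 1) (by omega) (by rwa [add_assoc, add_comm 1 k])
    have hrec := startSet_recurrent hS h1 h2 v
    have h6 := h5.entranceTime_one (hS := hS) (v := v) h1 h2 h3 hp
    rw [entranceTime_succ hrec k y, entranceTime_succ hrec k z]
    refine ⟨by rw [h6, h4], ?_⟩
    rw [add_comm, add_comm (entranceTime _ _ k z), Function.iterate_add_apply,
      Function.iterate_add_apply, ← h6]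
    exact h5.iterate h1 h2 h3 hp le_rfl

/-! ### Passage counts and return paths -/

open Classical in
variable (hS) in
/-- The vectors `c(ef)`, read off on the paths that start at `v ∈ V_1`. -/
noncomputable def passageCount (v : Fin m) (e f : S.E) (i : Fin m) : ℕ :=
  if h : ∃ y ∈ S.startSet v, edge y 0 = e ∧ edge y 1 = f then
    Set.ncard {n | n < entranceTime (vershik hS) (S.startSet v) 1 h.choose ∧
      (vershik hS)^[n] h.choose ∈ S.startSet i}
  else 0

open Classical in
variable (hS) in
/-- The paths `e₁^{(k)} e₂^{(k)}`, read off on the paths that start at `v ∈ V_1`. -/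
noncomputable def returnPath (v : Fin m) (k : ℕ) (e : Fin (k + 1) → S.E) : S.E × S.E :=
  if h : ∃ y ∈ S.startSet v, ∀ a : Fin (k + 1), edge y a = e a then
    (edge ((vershik hS)^[entranceTime (vershik hS) (S.startSet v) (k - 1) h.choose] h.choose) 0,
      edge ((vershik hS)^[entranceTime (vershik hS) (S.startSet v) (k - 1) h.choose] h.choose) 1)
  else (e 0, e 0)

theorem passageCount_eq (h1 : S.H1) (h2 : S.H2) (h3 : S.H3) {v : Fin m} {y : S.X}
    (hy : y ∈ S.startSet v) (i : Fin m) :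
    passageCount hS v (edge y 0) (edge y 1) i =
      Set.ncard {n | n < entranceTime (vershik hS) (S.startSet v) 1 y ∧
        (vershik hS)^[n] y ∈ S.startSet i} := by
  have h : ∃ z ∈ S.startSet v, edge z 0 = edge y 0 ∧ edge z 1 = edge y 1 := ⟨y, hy, rfl, rfl⟩
  rw [passageCount, dif_pos h]
  obtain ⟨-, hz⟩ := h.choose_spec
  generalize h.choose = z at hz
  have hag : Agree (1 + 1) z y := by
    intro i hi
    interval_cases i
    · exact hz.1
    · exact hz.2
  rw [hag.entranceTime_one h1 h2 h3 le_rfl]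
  congr 1
  ext n
  refine and_congr_right fun hn => ?_
  rw [← hag.entranceTime_one h1 h2 h3 le_rfl] at hn
  rw [mem_startSet, mem_startSet, (hag.iterate h1 h2 h3 le_rfl hn.le).term_eq (by omega)]

theorem returnPath_eq (h1 : S.H1) (h2 : S.H2) (h3 : S.H3) {v : Fin m} {y : S.X}
    (hy : y ∈ S.startSet v) {k : ℕ} (hk : 1 ≤ k) :
    returnPath hS v k (fun a => edge y a) =
      (edge ((vershik hS)^[entranceTime (vershik hS) (S.startSet v) (k - 1) y] y) 0,
        edge ((vershik hS)^[entranceTime (vershik hS) (S.startSet v) (k - 1) y] y) 1) := by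
  have h : ∃ z ∈ S.startSet v, ∀ a : Fin (k + 1), edge z a = edge y a := ⟨y, hy, fun _ => rfl⟩
  rw [returnPath, dif_pos h]
  obtain ⟨-, hz⟩ := h.choose_spec
  generalize h.choose = z at hz
  have hag : Agree (2 + (k - 1)) z y := fun i hi => hz ⟨i, by omega⟩
  obtain ⟨-, h4⟩ := hag.entranceTime_eq (hS := hS) (v := v) h1 h2 h3 (k - 1) (by omega)
  rw [h4 0 (by omega), h4 1 (by omega)]

/-- Both I and the minimal cylinders are levels of the same suspension, so `ncard_visits` reduces
the count to the tail, where n and I no longer occur. -/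
theorem isPassageCount_passageCount (h1 : S.H1) (h2 : S.H2) (h3 : S.H3) (v : Fin m) :
    S.IsPassageCount hS v (passageCount hS v) := by
  intro p x hx z hz i
  rw [cyl_eq h2 hx] at hz ⊢
  rw [minCyl_eq h2, (isSuspension_tail hS h2 p).ncard_visits (startSet_recurrent hS h1 h2 v)
    (rank_lt_of_mem_startSet hx) hz.1 hz.2]
  · exact passageCount_eq h1 h2 h3 hz.1 i
  · intro y hy y' hy' h
    rw [mem_startSet] at *
    rw [hy', ← h, hy]

theorem returnPath_spec (h1 : S.H1) (h2 : S.H2) (h3 : S.H3) {v : Fin m} {p : ℕ} {x z : S.X}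
    (hx : term x p = v) (hz : z ∈ cyl x (p + 1)) {k : ℕ} (hk : 1 ≤ k) :
    (vershik hS)^[entranceTime (vershik hS) (cyl x (p + 1)) (k - 1) z] z ∈ cyl x (p + 1) ∧
    returnPath hS v k (fun a => edge z (p + a)) =
      (edge ((vershik hS)^[entranceTime (vershik hS) (cyl x (p + 1)) (k - 1) z] z) p,
        edge ((vershik hS)^[entranceTime (vershik hS) (cyl x (p + 1)) (k - 1) z] z) (p + 1)) := by
  rw [cyl_eq h2 hx] at hz ⊢
  have hrec := startSet_recurrent hS h1 h2 v
  obtain ⟨h4, h5⟩ := (isSuspension_tail hS h2 p).iterate_entranceTime hrec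
    (rank_lt_of_mem_startSet hx) hz.1 hz.2 (k - 1)
  have hmem : (vershik hS)^[entranceTime (vershik hS) (S.startSet v) (k - 1) (tail h2 p z)]
      (tail h2 p z) ∈ S.startSet v := by
    cases k - 1 with
    | zero => exact hz.1
    | succ k => exact (entranceTime_succ_spec hrec k _).2
  refine ⟨⟨by rw [h4]; exact hmem, h5⟩, ?_⟩
  refine (returnPath_eq h1 h2 h3 hz.1 hk).trans ?_
  rw [← h4, edge_tail, edge_tail]
  rfl

theorem isReturnPath_returnPath (h1 : S.H1) (h2 : S.H2) (h3 : S.H3) (v : Fin m) :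
    S.IsReturnPath hS v (returnPath hS v) := by
  rintro p x hx z hz k hk w rfl
  exact returnPath_spec h1 h2 h3 hx hz hk

variable (hS) in
/-- The return time to a cylinder ending at `v ∈ V_{p+1}`, at the points with the edges `a` behind
that cylinder. -/
noncomputable def returnTime (v : Fin m) (p : ℕ) (a : S.E × S.E) : ℕ :=
  ∑ i, passageCount hS v a.1 a.2 i * hgt S p i

/-- The return time is the Birkhoff sum of heights along the excursion of the tail; grouping its
terms by vertex produces the passage counts. -/
theorem entranceTime_cyl (h1 : S.H1) (h2 : S.H2) (h3 : S.H3) {v : Fin m} {p : ℕ} {x z : S.X}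
    (hx : term x p = v) (hz : z ∈ cyl x (p + 1)) :
    entranceTime (vershik hS) (cyl x (p + 1)) 1 z =
      returnTime hS v p (edge z p, edge z (p + 1)) := by
  classical
  rw [cyl_eq h2 hx] at hz ⊢
  rw [(isSuspension_tail hS h2 p).entranceTime_eq (startSet_recurrent hS h1 h2 v)
    (rank_lt_of_mem_startSet hx) hz.2, suspSum, returnTime,
    ← Finset.sum_fiberwise (Finset.range _) fun b => term ((vershik hS)^[b] (tail h2 p z)) 0]
  refine Finset.sum_congr rfl fun i _ => ?_
  rw [Finset.sum_congr rfl (g := fun _ => hgt S p i), Finset.sum_const, smul_eq_mul]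
  · congr 1
    have := passageCount_eq (hS := hS) h1 h2 h3 hz.1 i
    refine Eq.trans ?_ this.symm
    rw [← Set.ncard_coe_finset]
    congr 1
    ext n
    simp [mem_startSet]
  · intro b hb
    rw [(Finset.mem_filter.1 hb).2]

theorem entranceTime_cyl_sub (h1 : S.H1) (h2 : S.H2) (h3 : S.H3) {v : Fin m} {p : ℕ} {x z : S.X}
    (hx : term x p = v) (hz : z ∈ cyl x (p + 1)) {k : ℕ} (hk : 1 ≤ k) :
    entranceTime (vershik hS) (cyl x (p + 1)) k z =
      entranceTime (vershik hS) (cyl x (p + 1)) (k - 1) z +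
        returnTime hS v p (returnPath hS v k fun a => edge z (p + a)) := by
  obtain ⟨h4, h5⟩ := returnPath_spec (hS := hS) h1 h2 h3 hx hz hk
  rw [h5, ← entranceTime_cyl h1 h2 h3 hx h4]
  obtain ⟨k, rfl⟩ := Nat.exists_eq_add_of_le' hk
  exact entranceTime_succ (cyl_recurrent hS h1 h2 x p) k z

/-- Time 0 is itself a visit to v. This makes every c̄(ef) positive. -/
theorem passageCount_pos (h1 : S.H1) (h2 : S.H2) (h3 : S.H3) {v : Fin m} {y : S.X}
    (hy : y ∈ S.startSet v) : 0 < passageCount hS v (edge y 0) (edge y 1) v := by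
  rw [passageCount_eq h1 h2 h3 hy, Set.ncard_pos ((Set.finite_lt_nat _).subset fun n hn => hn.1)]
  exact ⟨0, (entranceTime_succ_spec (startSet_recurrent hS h1 h2 v) 0 y).1, hy⟩

end StationaryDiagram

/-! ### The distribution of the entrance times -/

section EntranceLaw

open Filter Topology

variable {X : Type*} [MeasurableSpace X] {T : X → X} {μ : Measure X} [IsFiniteMeasure μ] {I : Set X}

theorem measurable_iterate_of_measurable {τ : X → ℕ} (hT : Measurable T) (hτ : Measurable τ) :
    Measurable fun x => T^[τ x] x := by
  have : Measurable fun x : ℕ × X => T^[x.1] x.2 :=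
    measurable_from_prod_countable_right fun n => hT.iterate n
  exact this.comp (hτ.prodMk measurable_id)

theorem measurable_entranceTime (hT : Measurable T) (hI : MeasurableSet I)
    (hrec : ∀ x, ∃ n, 0 < n ∧ T^[n] x ∈ I) (k : ℕ) : Measurable (entranceTime T I k) := by
  classical
  induction k with
  | zero => exact measurable_const
  | succ k ih =>
    have hex : ∀ x, ∃ n, entranceTime T I k x < n ∧ T^[n] x ∈ I := fun x =>
      ⟨_, entranceTime_succ_spec hrec k x⟩
    have heq : entranceTime T I (k + 1) = fun x => Nat.find (hex x) := by
      funext x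
      refine le_antisymm (Nat.sInf_le (Nat.find_spec (hex x))) ?_
      exact Nat.find_min' (hex x) (entranceTime_succ_spec hrec k x)
    rw [heq]
    refine measurable_find hex fun n => ?_
    exact (measurableSet_lt ih measurable_const).inter (hT.iterate n hI)

/-- The distribution of the entrance time, restricted to the entrances through `A`, in terms of the
excursions from `I`. -/
theorem measureReal_entranceTime_eq (hT : MeasurePreserving T μ μ) (hI : MeasurableSet I)
    (hrec : ∀ x, ∃ n, 0 < n ∧ T^[n] x ∈ I) {A : Set X} (hA : MeasurableSet A) (q : ℕ) :
    μ.real {x | entranceTime T I 1 x = q + 1 ∧ T^[entranceTime T I 1 x] x ∈ A} =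
      μ.real {x | x ∈ I ∧ q < entranceTime T I 1 x ∧ T^[entranceTime T I 1 x] x ∈ A} := by
  have hN := measurable_entranceTime hT.measurable hI hrec 1
  have hR := measurable_iterate_of_measurable hT.measurable hN
  set N := entranceTime T I 1
  set R : X → X := fun x => T^[N x] x with hRdef
  set a : ℕ → ℝ := fun q => μ.real {x | N x = q + 1 ∧ R x ∈ A}
  set b : ℕ → ℝ := fun q => μ.real {x | x ∈ I ∧ q < N x ∧ R x ∈ A}
  have mN : ∀ q, MeasurableSet {x | N x = q} := fun q => hN (measurableSet_singleton q)
  have mR : MeasurableSet {x | R x ∈ A} := hR hA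
  have mlt : ∀ q, MeasurableSet {x | q < N x} := fun q => measurableSet_lt measurable_const hN
  -- Pull back by T: if T x lies outside I, the entrance time of x is one larger and the entrance
  -- point is the same; the points with T x in I give the second term.
  have ha : ∀ q, a q = a (q + 1) + μ.real {x | x ∈ I ∧ N x = q + 1 ∧ R x ∈ A} := by
    intro q
    have m1 : MeasurableSet {x | x ∈ I ∧ N x = q + 1 ∧ R x ∈ A} := hI.inter ((mN _).inter mR)
    have h1 : a q = μ.real (T ⁻¹' {x | N x = q + 1 ∧ R x ∈ A}) :=
      (hT.measureReal_preimage ((mN _).inter mR).nullMeasurableSet).symm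
    rw [h1, ← hT.measureReal_preimage m1.nullMeasurableSet,
      ← measureReal_union _ (hT.measurable m1)]
    · congr 1
      ext x
      have hx : T x ∉ I → N x = N (T x) + 1 ∧ R x = R (T x) := by
        intro h
        have := entranceTime_one_of_notMem hrec h
        exact ⟨this, by simp only [hRdef]; rw [show N x = N (T x) + 1 from this]; rfl⟩
      have hx' : T x ∈ I → N x = 1 := entranceTime_one_of_mem
      have hpos := entranceTime_one_pos hrec (T x)
      simp only [Set.mem_preimage, Set.mem_ofPred_eq, Set.mem_union]
      by_cases h : T x ∈ I
      · simp [h, hx' h]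
      · simp [h, hx h]
    · rw [Set.disjoint_left]
      rintro x ⟨hx, -⟩ ⟨hx', -⟩
      have : N x = 1 := entranceTime_one_of_mem hx'
      omega
  have hb : ∀ q, b q = b (q + 1) + μ.real {x | x ∈ I ∧ N x = q + 1 ∧ R x ∈ A} := by
    intro q
    have m1 : MeasurableSet {x | x ∈ I ∧ N x = q + 1 ∧ R x ∈ A} := hI.inter ((mN _).inter mR)
    rw [← measureReal_union _ m1]
    · refine congrArg μ.real ?_
      ext x
      simp only [Set.mem_ofPred_eq, Set.mem_union]
      constructor
      · rintro ⟨h1, h2, h3⟩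
        rcases (Nat.succ_le_of_lt h2).eq_or_lt with h | h
        · exact Or.inr ⟨h1, h.symm, h3⟩
        · exact Or.inl ⟨h1, h, h3⟩
      · rintro (⟨h1, h2, h3⟩ | ⟨h1, h2, h3⟩)
        · exact ⟨h1, by omega, h3⟩
        · exact ⟨h1, by omega, h3⟩
    · rw [Set.disjoint_left]
      rintro x ⟨-, hx, -⟩ ⟨-, hx', -⟩
      omega
  -- Both sequences lose the same amount at each step. Since N is finite everywhere, both tend to 0,
  -- so they coincide.
  have hconst : ∀ q, a q - b q = a 0 - b 0 := by
    intro q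
    induction q with
    | zero => rfl
    | succ q ih => linarith [ha q, hb q]
  have htail : Tendsto (fun q => μ.real {x | q < N x}) atTop (𝓝 0) := by
    have h1 := tendsto_measure_iInter_atTop (μ := μ) (s := fun q : ℕ => {x | q < N x})
      (fun q => (mlt q).nullMeasurableSet)
      (fun i j hij x hx => lt_of_le_of_lt hij hx) ⟨0, measure_ne_top _ _⟩
    have h2 : ⋂ q : ℕ, {x | q < N x} = ∅ := by
      ext x
      simp only [Set.mem_iInter, Set.mem_ofPred_eq, Set.mem_empty_iff_false, iff_false, not_forall]
      exact ⟨N x, lt_irrefl _⟩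
    rw [h2, measure_empty] at h1
    exact (ENNReal.tendsto_toReal ENNReal.zero_ne_top).comp h1
  have hta : Tendsto a atTop (𝓝 0) := by
    refine squeeze_zero (fun q => measureReal_nonneg) (fun q => ?_) htail
    exact measureReal_mono fun x hx => by have := hx.1; simp only [Set.mem_ofPred_eq]; omega
  have htb : Tendsto b atTop (𝓝 0) :=
    squeeze_zero (fun q => measureReal_nonneg) (fun q => measureReal_mono fun x hx => hx.2.1) htail
  have h0 : a 0 - b 0 = 0 := by
    have h1 := hta.sub htb
    simp only [hconst, sub_zero] at h1
    exact tendsto_nhds_unique tendsto_const_nhds h1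
  have := hconst q
  change a q = b q
  linarith

variable {ι : Type*} (P : Finset ι) (D : ι → Set X) (τ : ι → ℕ) (Q : ι → Prop) [DecidablePred Q]

/-- The first entrance law in terms of a finite partition of `I` on whose atoms the return time is
constant and the entrance through `A` is decided. -/
theorem measureReal_entranceTime_le (hT : MeasurePreserving T μ μ) (hI : MeasurableSet I)
    (hrec : ∀ x, ∃ n, 0 < n ∧ T^[n] x ∈ I) {A : Set X} (hA : MeasurableSet A)
    (hD : ∀ e ∈ P, MeasurableSet (D e)) (hdisj : (P : Set ι).PairwiseDisjoint D)
    (hunion : I = ⋃ e ∈ P, D e) (hτ : ∀ e ∈ P, ∀ x ∈ D e, entranceTime T I 1 x = τ e)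
    (hQ : ∀ e ∈ P, ∀ x ∈ D e, (T^[entranceTime T I 1 x] x ∈ A ↔ Q e)) (u : ℕ) :
    μ.real {x | entranceTime T I 1 x ≤ u ∧ T^[entranceTime T I 1 x] x ∈ A} =
      ∑ e ∈ P with Q e, (min (τ e) u : ℕ) * μ.real (D e) := by
  have hN := measurable_entranceTime hT.measurable hI hrec 1
  have hR := measurable_iterate_of_measurable hT.measurable hN
  -- Among the slices q < u, an atom e with `Q e` is counted min (τ e) u times.
  have hslice : ∀ q, μ.real {x | x ∈ I ∧ q < entranceTime T I 1 x ∧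
      T^[entranceTime T I 1 x] x ∈ A} = ∑ e ∈ P with Q e, if q < τ e then μ.real (D e) else 0 := by
    intro q
    rw [Finset.sum_filter, ← Finset.sum_filter_add_sum_filter_not P (fun e => Q e ∧ q < τ e)]
    rw [Finset.sum_eq_zero (s := P.filter fun e => ¬ (Q e ∧ q < τ e)), add_zero,
      Finset.sum_congr rfl (g := fun e => μ.real (D e)), ← measureReal_biUnion_finset]
    · congr 1
      ext x
      simp only [Set.mem_ofPred_eq, Set.mem_iUnion, Finset.mem_filter, exists_prop]
      constructor
      · rintro ⟨h1, h2, h3⟩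
        rw [hunion] at h1
        simp only [Set.mem_iUnion, exists_prop] at h1
        obtain ⟨e, he, hx⟩ := h1
        exact ⟨e, ⟨he, (hQ e he x hx).1 h3, by rwa [← hτ e he x hx]⟩, hx⟩
      · rintro ⟨e, ⟨he, h1, h2⟩, hx⟩
        refine ⟨?_, by rwa [hτ e he x hx], (hQ e he x hx).2 h1⟩
        rw [hunion]
        simp only [Set.mem_iUnion, exists_prop]
        exact ⟨e, he, hx⟩
    · exact hdisj.subset fun e he => (Finset.mem_filter.1 he).1
    · exact fun e he => hD e (Finset.mem_filter.1 he).1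
    · intro e he
      have := (Finset.mem_filter.1 he).2
      rw [if_pos this.1, if_pos this.2]
    · intro e he
      have := (Finset.mem_filter.1 he).2
      split_ifs with h1 h2
      · exact absurd ⟨h1, h2⟩ this
      · rfl
      · rfl
  induction u with
  | zero =>
    have : {x | entranceTime T I 1 x ≤ 0 ∧ T^[entranceTime T I 1 x] x ∈ A} = ∅ := by
      ext x
      have := entranceTime_one_pos hrec x
      simp only [Set.mem_ofPred_eq, Set.mem_empty_iff_false, iff_false]
      omega
    rw [this]
    simp
  | succ u ih =>
    have hsplit : {x | entranceTime T I 1 x ≤ u + 1 ∧ T^[entranceTime T I 1 x] x ∈ A} =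
        {x | entranceTime T I 1 x ≤ u ∧ T^[entranceTime T I 1 x] x ∈ A} ∪
        {x | entranceTime T I 1 x = u + 1 ∧ T^[entranceTime T I 1 x] x ∈ A} := by
      ext x
      simp only [Set.mem_ofPred_eq, Set.mem_union, ← or_and_right, Nat.le_succ_iff]
    rw [hsplit, measureReal_union, ih, measureReal_entranceTime_eq hT hI hrec hA, hslice,
      ← Finset.sum_add_distrib]
    · refine Finset.sum_congr rfl fun e _ => ?_
      split_ifs with h
      · rw [min_eq_right h.le, min_eq_right (Nat.succ_le_of_lt h)]
        push_cast
        ring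
      · rw [min_eq_left (by omega), min_eq_left (by omega), add_zero]
    · rw [Set.disjoint_left]
      rintro x ⟨hx, -⟩ ⟨hx', -⟩
      omega
    · exact (hN (measurableSet_singleton _)).inter (hR hA)

/-- Once u exceeds the finitely many return times, every excursion counts with its full length, as
in Kac's formula. -/
theorem measureReal_entrance (hT : MeasurePreserving T μ μ) (hI : MeasurableSet I)
    (hrec : ∀ x, ∃ n, 0 < n ∧ T^[n] x ∈ I) {A : Set X} (hA : MeasurableSet A)
    (hD : ∀ e ∈ P, MeasurableSet (D e)) (hdisj : (P : Set ι).PairwiseDisjoint D)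
    (hunion : I = ⋃ e ∈ P, D e) (hτ : ∀ e ∈ P, ∀ x ∈ D e, entranceTime T I 1 x = τ e)
    (hQ : ∀ e ∈ P, ∀ x ∈ D e, (T^[entranceTime T I 1 x] x ∈ A ↔ Q e)) :
    μ.real {x | T^[entranceTime T I 1 x] x ∈ A} = ∑ e ∈ P with Q e, τ e * μ.real (D e) := by
  have h1 : Tendsto (fun u : ℕ => μ {x | entranceTime T I 1 x ≤ u ∧
      T^[entranceTime T I 1 x] x ∈ A}) atTop (𝓝 (μ {x | T^[entranceTime T I 1 x] x ∈ A})) := by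
    have h2 : {x | T^[entranceTime T I 1 x] x ∈ A} = ⋃ u : ℕ, {x | entranceTime T I 1 x ≤ u ∧
        T^[entranceTime T I 1 x] x ∈ A} := by
      ext x
      simp only [Set.mem_ofPred_eq, Set.mem_iUnion]
      exact ⟨fun h => ⟨_, le_rfl, h⟩, fun ⟨_, _, h⟩ => h⟩
    rw [h2]
    exact tendsto_measure_iUnion_atTop fun i j hij x hx => ⟨hx.1.trans hij, hx.2⟩
  have h3 := (ENNReal.tendsto_toReal (measure_ne_top μ _)).comp h1
  refine tendsto_nhds_unique h3 (tendsto_const_nhds.congr' ?_)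
  filter_upwards [eventually_ge_atTop (P.sup τ)] with u hu
  refine (Eq.trans (measureReal_entranceTime_le P D τ Q hT hI hrec hA hD hdisj hunion hτ hQ u)
    (Finset.sum_congr rfl fun e he => ?_)).symm
  rw [min_eq_left ((Finset.le_sup (Finset.mem_filter.1 he).1).trans hu)]

end EntranceLaw

/-! ### Contraction by positive matrices -/

section Perron

open Filter Topology Matrix

variable {ι : Type*} [Fintype ι] [Nonempty ι]

/-- The oscillation of the vector `w` does not exceed `b`. -/
def OscLE (w : ι → ℝ) (b : ℝ) : Prop := ∀ i j, w i - w j ≤ b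

/-- Every row averages w with weight at least δ on a minimiser, so the maximum falls by δ times the
oscillation, while the minimum does not decrease. -/
theorem OscLE.mulVec {P : Matrix ι ι ℝ} {δ : ℝ} (hδ0 : 0 < δ) (hδ : ∀ i j, δ ≤ P i j)
    (hsum : ∀ i, ∑ j, P i j = 1) {w : ι → ℝ} {b : ℝ} (hw : OscLE w b) :
    OscLE (P *ᵥ w) ((1 - δ) * b) := by
  obtain ⟨i₀, -, hi₀⟩ := Finset.exists_min_image Finset.univ w Finset.univ_nonempty
  obtain ⟨i₁, -, hi₁⟩ := Finset.exists_max_image Finset.univ w Finset.univ_nonempty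
  have hP : ∀ i j, 0 ≤ P i j := fun i j => hδ0.le.trans (hδ i j)
  have hδ1 : δ ≤ 1 :=
    (hδ i₀ i₀).trans ((Finset.single_le_sum (fun j _ => hP i₀ j) (Finset.mem_univ i₀)).trans
      (hsum i₀).le)
  have hosc : 0 ≤ w i₁ - w i₀ := sub_nonneg.2 (hi₀ i₁ (Finset.mem_univ _))
  have hup : ∀ i, (P *ᵥ w) i ≤ w i₁ - δ * (w i₁ - w i₀) := by
    intro i
    have h1 : w i₁ - (P *ᵥ w) i = ∑ j, P i j * (w i₁ - w j) := by
      simp only [Matrix.mulVec, dotProduct, mul_sub, Finset.sum_sub_distrib, ← Finset.sum_mul,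
        hsum, one_mul]
    have h2 : P i i₀ * (w i₁ - w i₀) ≤ ∑ j, P i j * (w i₁ - w j) :=
      Finset.single_le_sum (f := fun j => P i j * (w i₁ - w j))
        (fun j _ => mul_nonneg (hP i j) (sub_nonneg.2 (hi₁ j (Finset.mem_univ _))))
        (Finset.mem_univ i₀)
    have h3 := mul_le_mul_of_nonneg_right (hδ i i₀) hosc
    linarith
  have hlow : ∀ i, w i₀ ≤ (P *ᵥ w) i := by
    intro i
    have h1 : (P *ᵥ w) i - w i₀ = ∑ j, P i j * (w j - w i₀) := by
      simp only [Matrix.mulVec, dotProduct, mul_sub, Finset.sum_sub_distrib, ← Finset.sum_mul,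
        hsum, one_mul]
    have h2 : 0 ≤ ∑ j, P i j * (w j - w i₀) := Finset.sum_nonneg fun j _ =>
      mul_nonneg (hP i j) (sub_nonneg.2 (hi₀ j (Finset.mem_univ _)))
    linarith
  intro i j
  have h4 := mul_le_mul_of_nonneg_left (hw i₁ i₀) (sub_nonneg.2 hδ1)
  have := hup i
  have := hlow j
  linarith

/-- A positive matrix with a positive eigenvector contracts the oscillation relative to that
eigenvector. -/
theorem exists_contraction {M : Matrix ι ι ℝ} (hM : ∀ i j, 0 < M i j) {lam : ℝ} (hlam : 0 < lam)
    {r : ι → ℝ} (hr : M *ᵥ r = lam • r) (hr_pos : ∀ i, 0 < r i) :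
    ∃ δ : ℝ, 0 < δ ∧ δ ≤ 1 ∧ ∀ (u : ι → ℝ) (b : ℝ), OscLE (fun i => u i / r i) b →
      OscLE (fun i => (M *ᵥ u) i / (lam * r i)) ((1 - δ) * b) := by
  -- Conjugation by the eigenvector makes M row-stochastic; δ is its smallest entry.
  set P : Matrix ι ι ℝ := fun i j => M i j * r j / (lam * r i) with hP
  have hPpos : ∀ i j, 0 < P i j := fun i j =>
    div_pos (mul_pos (hM i j) (hr_pos j)) (mul_pos hlam (hr_pos i))
  obtain ⟨a, -, ha⟩ := Finset.exists_min_image Finset.univ (fun a : ι × ι => P a.1 a.2)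
    Finset.univ_nonempty
  have hsum : ∀ i, ∑ j, P i j = 1 := by
    intro i
    have h1 := congrFun hr i
    simp only [Matrix.mulVec, dotProduct, Pi.smul_apply, smul_eq_mul] at h1
    simp only [hP, ← Finset.sum_div, h1]
    exact div_self (mul_pos hlam (hr_pos i)).ne'
  have hδ : ∀ i j, P a.1 a.2 ≤ P i j := fun i j => ha (i, j) (Finset.mem_univ _)
  refine ⟨P a.1 a.2, hPpos _ _, ?_, fun u b hu => ?_⟩
  · exact (Finset.single_le_sum (fun j _ => (hPpos a.1 j).le) (Finset.mem_univ a.2)).trans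
      (hsum a.1).le
  · have := OscLE.mulVec (hPpos a.1 a.2) hδ hsum hu
    convert this using 2 with i
    simp only [Matrix.mulVec, dotProduct, hP, Finset.sum_div]
    refine Finset.sum_congr rfl fun j _ => ?_
    have := (hr_pos j).ne'
    field_simp

theorem tendsto_pow_one_sub_mul {δ : ℝ} (hδ : 0 < δ) (hδ1 : δ ≤ 1) (C : ℝ) :
    Tendsto (fun n : ℕ => (1 - δ) ^ n * C) atTop (𝓝 0) := by
  simpa using (tendsto_pow_atTop_nhds_zero_of_lt_one (sub_nonneg.2 hδ1) (by linarith)).mul_const C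

variable {M : Matrix ι ι ℝ} {lam : ℝ} {r l : ι → ℝ}

/-- The nonnegative sequences `f` with `f q = M f (q + 1)` are the multiples of `r / lam ^ q`. -/
theorem eq_of_eq_mulVec_succ (hM : ∀ i j, 0 < M i j) (hlam : 0 < lam) (hr : M *ᵥ r = lam • r)
    (hl : l ᵥ* M = lam • l) (hr_pos : ∀ i, 0 < r i) (hl_pos : ∀ i, 0 < l i) (hr_sum : ∑ i, r i = 1)
    {f : ℕ → ι → ℝ} (hf : ∀ q, f q = M *ᵥ f (q + 1)) (hf0 : ∀ q i, 0 ≤ f q i)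
    (hf1 : ∑ i, f 0 i = 1) (q : ℕ) (i : ι) : f q i = r i / lam ^ q := by
  obtain ⟨δ, hδ, hδ1, hcon⟩ := exists_contraction hM hlam hr hr_pos
  set w : ℕ → ι → ℝ := fun q i => lam ^ q * f q i / r i with hw
  -- The pairing with l is conserved; with nonnegativity it bounds w uniformly in q.
  have hK : ∀ q, ∑ i, l i * (lam ^ q * f q i) = ∑ i, l i * f 0 i := by
    intro q
    induction q with
    | zero => simp
    | succ q ih =>
      rw [← ih]
      have h1 : ∑ i, l i * f q i = lam * ∑ i, l i * f (q + 1) i := by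
        have : l ⬝ᵥ (M *ᵥ f (q + 1)) = (lam • l) ⬝ᵥ f (q + 1) := by
          rw [Matrix.dotProduct_mulVec, hl]
        rw [← hf q, smul_dotProduct] at this
        exact this
      simp only [mul_left_comm (l _), ← Finset.mul_sum, h1]
      ring
  set K := ∑ i, l i * f 0 i
  have hwnn : ∀ q i, 0 ≤ w q i := fun q i =>
    div_nonneg (mul_nonneg (pow_pos hlam q).le (hf0 q i)) (hr_pos i).le
  have hKnn : 0 ≤ K := Finset.sum_nonneg fun i _ => mul_nonneg (hl_pos i).le (hf0 0 i)
  have hbd : ∀ q i, w q i ≤ ∑ i, K / (l i * r i) := by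
    intro q i
    have h1 : l i * (lam ^ q * f q i) ≤ K := by
      rw [← hK q]
      exact Finset.single_le_sum (f := fun i => l i * (lam ^ q * f q i))
        (fun j _ => mul_nonneg (hl_pos j).le (mul_nonneg (pow_pos hlam q).le (hf0 q j)))
        (Finset.mem_univ i)
    have h2 : w q i ≤ K / (l i * r i) := by
      rw [hw, le_div_iff₀ (mul_pos (hl_pos i) (hr_pos i))]
      have : lam ^ q * f q i / r i * (l i * r i) = l i * (lam ^ q * f q i) := by
        have := (hr_pos i).ne'
        field_simp
      simp only [this, h1]
    exact h2.trans (Finset.single_le_sum (f := fun i => K / (l i * r i))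
      (fun j _ => div_nonneg hKnn (mul_pos (hl_pos j) (hr_pos j)).le) (Finset.mem_univ i))
  set C := ∑ i, K / (l i * r i)
  have hstep : ∀ q b, OscLE (w (q + 1)) b → OscLE (w q) ((1 - δ) * b) := by
    intro q b hb
    have := hcon (fun i => lam ^ (q + 1) * f (q + 1) i) b hb
    convert this using 2 with i
    have h1 : (M *ᵥ fun i => lam ^ (q + 1) * f (q + 1) i) i = lam ^ (q + 1) * f q i := by
      rw [hf q]
      exact congrFun (Matrix.mulVec_smul M (lam ^ (q + 1)) (f (q + 1))) i
    rw [h1, hw, pow_succ]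
    have := (hr_pos i).ne'
    field_simp
  -- The contraction goes from q + 1 to q. Starting n steps further out, where C still bounds the
  -- oscillation, forces the oscillation at q to vanish.
  have hosc : ∀ n q, OscLE (w q) ((1 - δ) ^ n * C) := by
    intro n
    induction n with
    | zero =>
      intro q i j
      rw [pow_zero, one_mul]
      linarith [hbd q i, hwnn q j]
    | succ n ih =>
      intro q
      have := hstep q _ (ih (q + 1))
      rwa [← mul_assoc, ← pow_succ'] at this
  have hconst : ∀ q i j, w q i = w q j := by
    intro q i j
    have h0 : ∀ i j, w q i - w q j ≤ 0 := fun i j =>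
      ge_of_tendsto' (tendsto_pow_one_sub_mul hδ hδ1 C) fun n => hosc n q i j
    linarith [h0 i j, h0 j i]
  have hfw : ∀ q i, f q i = w q i * r i / lam ^ q := by
    intro q i
    have := (hr_pos i).ne'
    rw [hw]
    field_simp
  obtain ⟨i₀⟩ := ‹Nonempty ι›
  have hw1 : ∀ q, w q i₀ = 1 := by
    intro q
    induction q with
    | zero =>
      have h1 : ∑ i, f 0 i = ∑ i, w 0 i₀ * r i :=
        Finset.sum_congr rfl fun i _ => by rw [hfw 0 i, hconst 0 i i₀, pow_zero, div_one]
      rw [hf1, ← Finset.mul_sum, hr_sum, mul_one] at h1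
      exact h1.symm
    | succ q ih =>
      have h1 : f (q + 1) = (w (q + 1) i₀ / lam ^ (q + 1)) • r := by
        funext i
        rw [hfw, hconst (q + 1) i i₀, Pi.smul_apply, smul_eq_mul]
        ring
      have h2 := congrFun (hf q) i₀
      rw [h1, Matrix.mulVec_smul, hr, hfw, ih, Pi.smul_apply, Pi.smul_apply, smul_eq_mul,
        smul_eq_mul, pow_succ] at h2
      have := (hr_pos i₀).ne'
      field_simp at h2
      exact h2.symm
  rw [hfw, hconst q i i₀, hw1, one_mul]

/-- The powers of a positive matrix, applied to a vector, converge to the left eigenvector. -/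
theorem tendsto_of_eq_vecMul (hM : ∀ i j, 0 < M i j) (hlam : 0 < lam) (hr : M *ᵥ r = lam • r)
    (hl : l ᵥ* M = lam • l) (hr_pos : ∀ i, 0 < r i) (hl_pos : ∀ i, 0 < l i)
    (hlr_sum : ∑ i, l i * r i = 1) {h : ℕ → ι → ℝ} (hh : ∀ n, h (n + 1) = h n ᵥ* M)
    (hh0 : ∑ i, h 0 i * r i = 1) (i : ι) :
    Tendsto (fun n => h n i / lam ^ n) atTop (𝓝 (l i)) := by
  have hl' : Mᵀ *ᵥ l = lam • l := by rw [Matrix.mulVec_transpose, hl]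
  obtain ⟨δ, hδ, hδ1, hcon⟩ := exists_contraction (M := Mᵀ) (fun i j => hM j i) hlam hl' hl_pos
  set w : ℕ → ι → ℝ := fun n i => h n i / lam ^ n / l i with hw
  have hstep : ∀ n b, OscLE (w n) b → OscLE (w (n + 1)) ((1 - δ) * b) := by
    intro n b hb
    have := hcon (fun i => h n i / lam ^ n) b hb
    convert this using 2 with i
    have h1 : (Mᵀ *ᵥ fun i => h n i / lam ^ n) i = h (n + 1) i / lam ^ n := by
      have h2 : (fun i => h n i / lam ^ n) = (lam ^ n)⁻¹ • h n := by
        funext i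
        rw [Pi.smul_apply, smul_eq_mul, div_eq_inv_mul]
      rw [h2, Matrix.mulVec_smul, Matrix.mulVec_transpose, ← hh, Pi.smul_apply, smul_eq_mul,
        div_eq_inv_mul]
    rw [h1, hw]
    simp only [pow_succ, div_div, mul_assoc]
  set C := ∑ i, ∑ j, |w 0 i - w 0 j|
  have hosc : ∀ n, OscLE (w n) ((1 - δ) ^ n * C) := by
    intro n
    induction n with
    | zero =>
      intro i j
      rw [pow_zero, one_mul]
      have h1 := Finset.single_le_sum (f := fun j => |w 0 i - w 0 j|) (fun j _ => abs_nonneg _)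
        (Finset.mem_univ j)
      have h2 := Finset.single_le_sum (f := fun i => ∑ j, |w 0 i - w 0 j|)
        (fun i _ => Finset.sum_nonneg fun j _ => abs_nonneg _) (Finset.mem_univ i)
      exact (le_abs_self _).trans (h1.trans h2)
    | succ n ih =>
      have := hstep n _ ih
      rwa [← mul_assoc, ← pow_succ'] at this
  -- The mean of w n with weights l r is conserved, so shrinking oscillation leaves 1 as the only
  -- possible limit.
  have hmean : ∀ n, ∑ j, l j * r j * w n j = 1 := by
    intro n
    have h1 : ∀ n, ∑ j, h n j * r j = lam ^ n := by
      intro n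
      induction n with
      | zero => rw [hh0, pow_zero]
      | succ n ih =>
        have : (h n ᵥ* M) ⬝ᵥ r = h n ⬝ᵥ (lam • r) := by
          rw [← Matrix.dotProduct_mulVec, hr]
        rw [← hh, dotProduct_smul] at this
        refine this.trans ?_
        rw [smul_eq_mul, dotProduct, ih, pow_succ']
    have h2 : ∑ j, l j * r j * w n j = (∑ j, h n j * r j) / lam ^ n := by
      rw [Finset.sum_div]
      refine Finset.sum_congr rfl fun j _ => ?_
      have := (hl_pos j).ne'
      rw [hw]
      field_simp
    rw [h2, h1, div_self (pow_pos hlam n).ne']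
  have hwlim : Tendsto (fun n => w n i) atTop (𝓝 1) := by
    rw [tendsto_iff_dist_tendsto_zero]
    refine squeeze_zero (fun n => dist_nonneg) (fun n => ?_) (tendsto_pow_one_sub_mul hδ hδ1 C)
    have h1 : w n i - 1 = ∑ j, l j * r j * (w n i - w n j) := by
      simp only [mul_sub, Finset.sum_sub_distrib, hmean, ← Finset.sum_mul, hlr_sum, one_mul]
    have hpos : ∀ j, 0 ≤ l j * r j := fun j => (mul_pos (hl_pos j) (hr_pos j)).le
    have hC : ∀ c : ℝ, ∑ j, l j * r j * c = c := fun c => by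
      rw [← Finset.sum_mul, hlr_sum, one_mul]
    rw [Real.dist_eq, abs_le, h1]
    constructor
    · rw [← hC (-((1 - δ) ^ n * C))]
      exact Finset.sum_le_sum fun j _ =>
        mul_le_mul_of_nonneg_left (by linarith [hosc n j i]) (hpos j)
    · rw [← hC ((1 - δ) ^ n * C)]
      exact Finset.sum_le_sum fun j _ => mul_le_mul_of_nonneg_left (hosc n i j) (hpos j)
  have := hwlim.mul_const (l i)
  rw [one_mul] at this
  refine this.congr fun n => ?_
  rw [hw, div_mul_cancel₀ _ (hl_pos i).ne']

end Perron

namespace StationaryDiagram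

open OrderedBratteliDiagram Filter Topology

variable {m : ℕ} {S : StationaryDiagram m}

/-! ### The incidence matrix -/

open Classical in
theorem M_eq_card (i j : Fin m) :
    S.M i j = (Finset.card {e : S.E | S.s e = i ∧ S.t e = j} : ℝ) := by
  rw [M, Nat.card_eq_fintype_card, Fintype.card_subtype]

open Classical in
theorem sum_source_eq (i : Fin m) (f : Fin m → ℝ) :
    ∑ e : S.E with S.s e = i, f (S.t e) = ∑ j, S.M i j * f j := by
  rw [← Finset.sum_fiberwise _ S.t]
  refine Finset.sum_congr rfl fun j _ => ?_
  rw [Finset.filter_filter, Finset.sum_congr rfl (g := fun _ => f j), Finset.sum_const,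
    nsmul_eq_mul, M_eq_card]
  intro e he
  rw [(Finset.mem_filter.1 he).2.2]

open Classical in
theorem sum_target_eq (j : Fin m) (f : Fin m → ℝ) :
    ∑ e : S.E with S.t e = j, f (S.s e) = ∑ i, f i * S.M i j := by
  rw [← Finset.sum_fiberwise _ S.s]
  refine Finset.sum_congr rfl fun i _ => ?_
  rw [Finset.filter_filter, Finset.sum_congr rfl (g := fun _ => f i), Finset.sum_const,
    nsmul_eq_mul, M_eq_card, mul_comm]
  · simp only [and_comm]
  · intro e he
    rw [(Finset.mem_filter.1 he).2.2]

theorem one_le_M (h1 : S.H1) (i j : Fin m) : 1 ≤ S.M i j := by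
  have := h1 i j
  rw [M] at this ⊢
  exact_mod_cast this

/-! ### The Perron eigenvalue and the growth of the towers -/

variable {lam : ℝ} {r l : Fin m → ℝ}

theorem lam_pos [NeZero m] (h1 : S.H1) (hr : Matrix.mulVec S.M r = lam • r)
    (hr_pos : ∀ i, 0 < r i) : 0 < lam := by
  have h := congrFun hr 0
  simp only [Matrix.mulVec, dotProduct, Pi.smul_apply, smul_eq_mul] at h
  have hpos : 0 < ∑ j, S.M 0 j * r j :=
    Finset.sum_pos (fun j _ => mul_pos (h1 0 j) (hr_pos j)) ⟨0, Finset.mem_univ _⟩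
  rw [h] at hpos
  exact pos_of_mul_pos_left hpos (hr_pos 0).le

/-- The entries of M are at least 1, so an eigenvalue at most 1 leaves room for only one vertex and
one edge, hence one path. -/
theorem one_lt_lam [Infinite S.X] (h1 : S.H1) (h2 : S.H2) (hr : Matrix.mulVec S.M r = lam • r)
    (hr_pos : ∀ i, 0 < r i) : 1 < lam := by
  classical
  by_contra! hle
  have hrow : ∀ i, ∑ j, S.M i j * r j ≤ r i := by
    intro i
    have h := congrFun hr i
    simp only [Matrix.mulVec, dotProduct, Pi.smul_apply, smul_eq_mul] at h
    rw [h]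
    nlinarith [hr_pos i]
  have hvert : ∀ i j : Fin m, i = j := by
    intro i j
    by_contra hij
    have h3 : S.M i i * r i + S.M i j * r j ≤ ∑ k, S.M i k * r k := by
      rw [← Finset.sum_pair (f := fun k => S.M i k * r k) hij]
      exact Finset.sum_le_sum_of_subset_of_nonneg (Finset.subset_univ _)
        fun k _ _ => (mul_pos (h1 i k) (hr_pos k)).le
    nlinarith [hrow i, hr_pos i, hr_pos j, one_le_M h1 i i, one_le_M h1 i j]
  have hM1 : ∀ i, S.M i i ≤ 1 := by
    intro i
    have h3 : S.M i i * r i ≤ ∑ k, S.M i k * r k :=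
      Finset.single_le_sum (f := fun k => S.M i k * r k)
        (fun k _ => (mul_pos (h1 i k) (hr_pos k)).le) (Finset.mem_univ i)
    by_contra! hlt
    nlinarith [hrow i, hr_pos i]
  have hedge : ∀ e f : S.E, e = f := by
    intro e f
    have h3 := hM1 (S.s e)
    rw [M_eq_card, Nat.cast_le_one, Finset.card_le_one] at h3
    exact h3 e (by simp [hvert (S.t e) (S.s e)]) f
      (by simp [hvert (S.t f) (S.s e), hvert (S.s f) (S.s e)])
  have : Subsingleton S.X := ⟨fun z w => path_ext h2 fun k => hedge _ _⟩
  exact not_finite S.X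

/-- The heights of the towers grow like `lam ^ p`. -/
theorem tendsto_hgt [NeZero m] (h1 : S.H1) (hr : Matrix.mulVec S.M r = lam • r)
    (hl : Matrix.vecMul l S.M = lam • l) (hr_pos : ∀ i, 0 < r i) (hl_pos : ∀ i, 0 < l i)
    (hr_sum : ∑ i, r i = 1) (hlr_sum : ∑ i, l i * r i = 1) (i : Fin m) :
    Tendsto (fun p => (hgt S p i : ℝ) / lam ^ p) atTop (𝓝 (l i)) := by
  classical
  refine tendsto_of_eq_vecMul h1 (lam_pos h1 hr hr_pos) hr hl hr_pos hl_pos hlr_sum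
    (h := fun p i => (hgt S p i : ℝ)) (fun p => ?_) ?_ i
  · funext j
    rw [hgt, Nat.cast_sum]
    exact sum_target_eq j fun i => (hgt S p i : ℝ)
  · simpa [hgt] using hr_sum

/-! ### The invariant measure of the cylinders -/

theorem measurableSet_cyl (x : S.X) (n : ℕ) : MeasurableSet (cyl x n) :=
  MeasurableSpace.measurableSet_generateFrom ⟨x, n, rfl⟩

variable (S) in
/-- The cylinder of the path of rank `a` among the paths from the root to `i ∈ V_{q+1}`. -/
def rankCyl (q : ℕ) (i : Fin m) (a : ℕ) : Set S.X := {z | term z q = i ∧ rank q z = a}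

theorem cyl_eq_rankCyl (h2 : S.H2) (x : S.X) (q : ℕ) :
    cyl x (q + 1) = S.rankCyl q (term x q) (rank q x) := by
  ext z
  exact mem_cyl_iff h2

theorem measurableSet_rankCyl (h2 : S.H2) (q : ℕ) (i : Fin m) (a : ℕ) :
    MeasurableSet (S.rankCyl q i a) := by
  rcases (S.rankCyl q i a).eq_empty_or_nonempty with h | ⟨x, rfl, rfl⟩
  · rw [h]
    exact MeasurableSet.empty
  · rw [← cyl_eq_rankCyl h2]
    exact measurableSet_cyl x _

variable {hS : S.toDiagram.ProperlyOrdered} {μ : Measure S.X}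

theorem vershik_preimage_rankCyl (h2 : S.H2) {q a : ℕ} {i : Fin m} (ha : a + 1 < hgt S q i) :
    vershik hS ⁻¹' S.rankCyl q i (a + 1) = S.rankCyl q i a := by
  have hsucc : ∀ z : S.X, rank q z + 1 < hgt S q (term z q) →
      rank q (vershik hS z) = rank q z + 1 ∧ term (vershik hS z) q = term z q := by
    intro z hz
    obtain ⟨h3, h4⟩ := vershik_of_rank_lt (hS := hS) h2 hz
    refine ⟨h3, ?_⟩
    have := congrArg (fun y => term y 0) h4
    simpa only [term_tail, add_zero] using this
  ext z
  constructor
  · rintro ⟨h3, h4⟩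
    rcases (Nat.succ_le_of_lt (rank_lt q z)).lt_or_eq with h | h
    · obtain ⟨h5, h6⟩ := hsucc z h
      exact ⟨by rw [← h6, h3], by omega⟩
    · have := (vershik_of_rank_eq (hS := hS) h2 h).1
      omega
  · rintro ⟨rfl, rfl⟩
    obtain ⟨h5, h6⟩ := hsucc z ha
    exact ⟨h6, h5⟩

theorem measureReal_rankCyl (h2 : S.H2) (hμ : MeasurePreserving (vershik hS) μ μ) {q a : ℕ}
    {i : Fin m} (ha : a < hgt S q i) : μ.real (S.rankCyl q i a) = μ.real (S.rankCyl q i 0) := by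
  induction a with
  | zero => rfl
  | succ a ih =>
    rw [← ih (by omega), ← vershik_preimage_rankCyl (hS := hS) h2 ha,
      hμ.measureReal_preimage (measurableSet_rankCyl h2 q i _).nullMeasurableSet]

variable [IsProbabilityMeasure μ]

/-- Cut the cylinder by its next edge. Each piece is a level of a tower of the next order, and by
invariance has the measure of the bottom level. -/
theorem measureReal_rankCyl_eq_sum (h2 : S.H2) (hμ : MeasurePreserving (vershik hS) μ μ) (q : ℕ)
    (i : Fin m) :
    μ.real (S.rankCyl q i 0) = ∑ j, S.M i j * μ.real (S.rankCyl (q + 1) j 0) := by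
  classical
  rw [← sum_source_eq i fun j => μ.real (S.rankCyl (q + 1) j 0)]
  have hlt : ∀ e : S.E, ∑ g : S.E with g < e, hgt S q (S.s g) < hgt S (q + 1) (S.t e) := by
    intro e
    have := sum_lt_add_le_sum_target (fun g => hgt S q (S.s g)) e
    have := hgt_pos (S := S) q (S.s e)
    rw [hgt]
    omega
  have hD : ∀ e : S.E, {z | rank q z = 0 ∧ edge z q = e} =
      S.rankCyl (q + 1) (S.t e) (∑ g : S.E with g < e, hgt S q (S.s g)) := by
    intro e
    ext z
    constructor
    · rintro ⟨h3, rfl⟩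
      exact ⟨rfl, by rw [rank, h3, zero_add]⟩
    · rintro ⟨h3, h4⟩
      rw [rank] at h4
      have hz := rank_lt q z
      rw [term_eq_source] at hz
      obtain ⟨h5, h6⟩ := eq_of_sum_lt_add_eq (fun g => hgt S q (S.s g)) (e := edge z q) (f := e)
        (a := rank q z) (b := 0) h3 hz (hgt_pos _ _) (by rw [h4, zero_add])
      exact ⟨h6, h5⟩
  rw [Finset.sum_congr rfl fun e _ => ((congrArg μ.real (hD e)).trans
    (measureReal_rankCyl h2 hμ (hlt e))).symm, ← measureReal_biUnion_finset]
  · congr 1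
    ext z
    simp only [Set.mem_iUnion, Finset.mem_filter, Finset.mem_univ, true_and, exists_prop]
    constructor
    · rintro ⟨h3, h4⟩
      exact ⟨edge z q, by rw [← h3, term_eq_source], h4, rfl⟩
    · rintro ⟨e, rfl, h4, rfl⟩
      exact ⟨term_eq_source z q, h4⟩
  · intro e _ f _ hef
    rw [Function.onFun, Set.disjoint_left]
    rintro z ⟨-, rfl⟩ ⟨-, rfl⟩
    exact hef rfl
  · intro e _
    rw [hD]
    exact measurableSet_rankCyl h2 _ _ _

/-- The relation between consecutive levels and the total mass 1 determine the values. The exponent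
is the number of stationary edges, one less than the length of the cylinder. -/
theorem measureReal_cyl [NeZero m] (h1 : S.H1) (h2 : S.H2)
    (hμ : MeasurePreserving (vershik hS) μ μ) (hr : Matrix.mulVec S.M r = lam • r)
    (hl : Matrix.vecMul l S.M = lam • l) (hr_pos : ∀ i, 0 < r i) (hl_pos : ∀ i, 0 < l i)
    (hr_sum : ∑ i, r i = 1) (x : S.X) (q : ℕ) :
    μ.real (cyl x (q + 1)) = r (term x q) / lam ^ q := by
  rw [cyl_eq_rankCyl h2, measureReal_rankCyl h2 hμ (rank_lt q x)]
  refine eq_of_eq_mulVec_succ h1 (lam_pos h1 hr hr_pos) hr hl hr_pos hl_pos hr_sum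
    (f := fun q i => μ.real (S.rankCyl q i 0)) (fun q => ?_) (fun q i => measureReal_nonneg) ?_ q _
  · funext i
    exact measureReal_rankCyl_eq_sum h2 hμ q i
  · rw [← measureReal_biUnion_finset]
    · rw [← probReal_univ (μ := μ)]
      congr 1
      ext z
      simp only [Set.mem_iUnion, Finset.mem_univ, exists_prop, true_and, Set.mem_univ, iff_true]
      exact ⟨term z 0, rfl, rfl⟩
    · intro i _ j _ hij
      rw [Function.onFun, Set.disjoint_left]
      rintro z ⟨rfl, -⟩ ⟨rfl, -⟩
      exact hij rfl
    · exact fun i _ => measurableSet_rankCyl h2 _ _ _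

/-! ### Extending finite paths -/

theorem exists_chain (v : Fin m) :
    ∃ f : ℕ → S.E, S.s (f 0) = v ∧ ∀ k, S.t (f k) = S.s (f (k + 1)) := by
  choose g hg using S.s_surj
  refine ⟨fun n => Nat.rec (g v) (fun _ e => g (S.t e)) n, hg v, fun k => (hg _).symm⟩

theorem exists_chain_splice (n : ℕ) {f g : ℕ → S.E} (hf : ∀ k, k + 1 < n → S.t (f k) = S.s (f (k + 1)))
    (hfg : ∀ k, k + 1 = n → S.t (f k) = S.s (g 0)) (hg : ∀ k, S.t (g k) = S.s (g (k + 1))) :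
    ∃ F : ℕ → S.E, (∀ k < n, F k = f k) ∧ (∀ k, F (n + k) = g k) ∧
      ∀ k, S.t (F k) = S.s (F (k + 1)) := by
  refine ⟨fun k => if k < n then f k else g (k - n), fun k hk => if_pos hk, fun k => ?_, fun k => ?_⟩
  · simp
  · rcases lt_trichotomy (k + 1) n with h | h | h
    · simp [h, (show k < n by omega), hf k h]
    · simp [h, (show k < n by omega), hfg k h]
    · have h3 : ¬ k < n := by omega
      have h4 : ¬ k + 1 < n := by omega
      simp only [h3, h4, if_false]
      rw [hg, show k - n + 1 = k + 1 - n by omega]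

theorem mem_pathsFrom {v : Fin m} {k : ℕ} {e : Fin (k + 1) → S.E} :
    e ∈ S.pathsFrom v k ↔ S.s (e 0) = v ∧ ∀ a : Fin k, S.t (e a.castSucc) = S.s (e a.succ) := by
  simp [pathsFrom]

theorem mem_pairsFrom {v : Fin m} {a : S.E × S.E} :
    a ∈ S.pairsFrom v ↔ S.s a.1 = v ∧ S.t a.1 = S.s a.2 := by
  simp [pairsFrom]

/-- Passage counts and return paths are read off on points, so a finite path must be realised by
one: splice it behind x and continue it by any chain. -/
theorem exists_mem_cyl (h2 : S.H2) {v : Fin m} {p : ℕ} {x : S.X} (hx : term x p = v) {k : ℕ}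
    {e : Fin (k + 1) → S.E} (he : e ∈ S.pathsFrom v k) :
    ∃ z ∈ cyl x (p + 1), ∀ a : Fin (k + 1), edge z (p + a) = e a := by
  obtain ⟨he0, he1⟩ := mem_pathsFrom.1 he
  obtain ⟨g, hg0, hg⟩ := exists_chain (S := S) (S.t (e (Fin.last k)))
  obtain ⟨F, hF1, -, hF⟩ := exists_chain_splice (k + 1)
    (f := fun n => if h : n < k + 1 then e ⟨n, h⟩ else e 0) (g := g)
    (fun a ha => by
      have h3 : a < k + 1 := by omega
      simp only [h3, ha, dif_pos]
      exact he1 ⟨a, by omega⟩)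
    (fun a ha => by
      obtain rfl : a = k := by omega
      simp only [Nat.lt_succ_self, dif_pos, hg0]
      rfl) hg
  have hFe : ∀ a : Fin (k + 1), F a = e a := fun a => by rw [hF1 a a.2, dif_pos a.2]
  obtain ⟨G, hG1, hG2, hG⟩ := exists_chain_splice p (f := edge x) (g := F)
    (fun k _ => target_edge x k)
    (fun k hk => by
      have h3 : F 0 = e 0 := hFe 0
      rw [h3, he0, ← hx, ← hk]
      rfl) hF
  refine ⟨ofEdges h2 G hG, (mem_cyl_iff h2).2 ⟨?_, rank_congr fun i hi => hG1 i hi⟩, fun a => ?_⟩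
  · have h3 : F 0 = e 0 := hFe 0
    have h4 := hG2 0
    rw [add_zero] at h4
    rw [term_eq_source, edge_ofEdges, h4, h3, he0, hx]
  · rw [edge_ofEdges, hG2, hFe]

/-- The set `[I e₁ … e_{k+1}]`, for the cylinder `I` of the first `p + 1` edges of `x`. -/
def cylExt (x : S.X) (p : ℕ) {k : ℕ} (e : Fin (k + 1) → S.E) : Set S.X :=
  {z | z ∈ cyl x (p + 1) ∧ ∀ a : Fin (k + 1), edge z (p + a) = e a}

theorem exists_cylExt_eq (h2 : S.H2) {v : Fin m} {p : ℕ} {x : S.X} (hx : term x p = v) {k : ℕ}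
    {e : Fin (k + 1) → S.E} (he : e ∈ S.pathsFrom v k) :
    ∃ z : S.X, cylExt x p e = cyl z (p + k + 1 + 1) ∧ term z (p + k + 1) = S.t (e (Fin.last k)) := by
  obtain ⟨z, hz, hze⟩ := exists_mem_cyl h2 hx he
  refine ⟨z, ?_, ?_⟩
  · ext w
    constructor
    · rintro ⟨hw, hwe⟩ i hi
      by_cases h : i < p + 1
      · rw [hw i h, hz i h]
      · obtain ⟨a, rfl⟩ := Nat.exists_eq_add_of_le (not_lt.1 h)
        have h3 := (hwe ⟨a, by omega⟩).trans (hze ⟨a, by omega⟩).symm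
        rw [add_right_comm]
        exact h3
    · intro hw
      refine ⟨fun i hi => (hw i (by omega)).trans (hz i hi), fun a => ?_⟩
      rw [← hze a]
      exact hw (p + a + 1) (by omega)
  · rw [term_succ, ← hze (Fin.last k)]
    rfl

theorem iUnion_cylExt {v : Fin m} {p : ℕ} {x : S.X} (hx : term x p = v) (k : ℕ) :
    cyl x (p + 1) = ⋃ e ∈ S.pathsFrom v k, cylExt x p e := by
  ext z
  simp only [Set.mem_iUnion, exists_prop]
  constructor
  · intro hz
    refine ⟨fun a => edge z (p + a), mem_pathsFrom.2 ⟨?_, fun a => ?_⟩, hz, fun a => rfl⟩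
    · rw [← hx, ← show term z p = term x p from congrArg (S.toDiagram.t p) (hz p (by omega)),
        term_eq_source]
      rfl
    · exact target_edge z (p + a)
  · rintro ⟨e, -, hz, -⟩
    exact hz

theorem pairwiseDisjoint_cylExt (x : S.X) (p : ℕ) {k : ℕ} (A : Set (Fin (k + 1) → S.E)) :
    A.PairwiseDisjoint (cylExt x p) := by
  intro e _ f _ hef
  rw [Function.onFun, Set.disjoint_left]
  rintro z ⟨-, hz⟩ ⟨-, hz'⟩
  exact hef (funext fun a => (hz a).symm.trans (hz' a))

end StationaryDiagram

namespace StationaryDiagram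

open OrderedBratteliDiagram Filter Topology

variable {m : ℕ} {S : StationaryDiagram m}

/-! ### The thresholds -/

section Thresholds

variable {v : Fin m} {c : S.E → S.E → Fin m → ℕ} {l r : Fin m → ℝ}

theorem mem_Sset_succ {i : ℕ} {a : S.E × S.E} : a ∈ Sset v c l (i + 1) ↔
    ∃ h : i < (cvals v c l).card, a ∈ S.pairsFrom v ∧
      cbar c l a = (cvals v c l).orderEmbOfFin rfl ⟨i, h⟩ := by
  rw [Sset]
  split_ifs with h
  · simp [h]
  · simp [h]

theorem d_succ_of_lt {i : ℕ} (h : i < (cvals v c l).card) :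
    d v c l r (i + 1) = (((cvals v c l).orderEmbOfFin rfl ⟨i, h⟩ * r v : ℝ) : EReal) := by
  rw [d, dif_pos h]

theorem exists_index {a : S.E × S.E} (ha : a ∈ S.pairsFrom v) :
    ∃ (i : ℕ) (h : i < (cvals v c l).card),
      cbar c l a = (cvals v c l).orderEmbOfFin rfl ⟨i, h⟩ := by
  have hmem : cbar c l a ∈ cvals v c l := Finset.mem_image_of_mem _ ha
  rw [← Finset.mem_coe, ← Finset.range_orderEmbOfFin (cvals v c l) rfl] at hmem
  obtain ⟨⟨i, h⟩, hi⟩ := hmem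
  exact ⟨i, h, hi.symm⟩

/-- Between consecutive thresholds `d_j` and `d_{j+1}`, the paths of `S(1) ∪ ⋯ ∪ S(j)` are those
whose threshold has been passed. -/
theorem index_lt_iff (hr : 0 < r v) {j : ℕ} {u : ℝ} (hj : d v c l r j ≤ u)
    (hj' : u < d v c l r (j + 1)) {i : ℕ} (h : i < (cvals v c l).card) :
    i < j ↔ (cvals v c l).orderEmbOfFin rfl ⟨i, h⟩ * r v ≤ u := by
  constructor
  · intro hij
    obtain ⟨k, rfl⟩ := Nat.exists_eq_succ_of_ne_zero (Nat.ne_zero_of_lt hij)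
    by_cases hk : k < (cvals v c l).card
    · rw [d_succ_of_lt hk, EReal.coe_le_coe_iff] at hj
      refine le_trans (mul_le_mul_of_nonneg_right ?_ hr.le) hj
      exact ((cvals v c l).orderEmbOfFin rfl).monotone (Fin.mk_le_mk.2 (by omega))
    -- Here the threshold d_j is ∞, which the real number u cannot reach.
    · rw [d, dif_neg hk] at hj
      exact absurd (top_le_iff.1 hj) (EReal.coe_ne_top u)
  · intro hle
    by_contra hij
    have hjc : j < (cvals v c l).card := by omega
    rw [d_succ_of_lt hjc, EReal.coe_lt_coe_iff] at hj'
    refine absurd (hj'.trans_le ?_) (not_lt_of_ge hle)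
    refine mul_le_mul_of_nonneg_right ?_ hr.le
    exact ((cvals v c l).orderEmbOfFin rfl).monotone (Fin.mk_le_mk.2 (by omega))

theorem mem_biUnion_Sset_iff [DecidableEq (S.E × S.E)] (hr : 0 < r v) {j : ℕ} {u : ℝ}
    (hj : d v c l r j ≤ u) (hj' : u < d v c l r (j + 1)) {a : S.E × S.E} :
    a ∈ (Finset.Icc 1 j).biUnion (Sset v c l) ↔ a ∈ S.pairsFrom v ∧ cbar c l a * r v ≤ u := by
  simp only [Finset.mem_biUnion, Finset.mem_Icc]
  constructor
  · rintro ⟨i, ⟨hi, hij⟩, ha⟩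
    obtain ⟨i, rfl⟩ := Nat.exists_eq_add_of_le' hi
    obtain ⟨h, ha, hc⟩ := mem_Sset_succ.1 ha
    exact ⟨ha, by rw [hc]; exact (index_lt_iff hr hj hj' h).1 (by omega)⟩
  · rintro ⟨ha, hle⟩
    obtain ⟨i, h, hc⟩ := exists_index (c := c) (l := l) ha
    rw [hc] at hle
    have := (index_lt_iff hr hj hj' h).2 hle
    exact ⟨i + 1, ⟨by omega, by omega⟩, mem_Sset_succ.2 ⟨h, ha, hc⟩⟩

theorem mem_biUnion_Sset_iff_not [DecidableEq (S.E × S.E)] (hr : 0 < r v) {j : ℕ} {u : ℝ}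
    (hj : d v c l r j ≤ u) (hj' : u < d v c l r (j + 1)) {a : S.E × S.E} :
    a ∈ (Finset.Icc (j + 1) (cvals v c l).card).biUnion (Sset v c l) ↔
      a ∈ S.pairsFrom v ∧ ¬ cbar c l a * r v ≤ u := by
  simp only [Finset.mem_biUnion, Finset.mem_Icc]
  constructor
  · rintro ⟨i, ⟨hi, hij⟩, ha⟩
    obtain ⟨i, rfl⟩ := Nat.exists_eq_add_of_le' (le_trans (by omega : 1 ≤ j + 1) hi)
    obtain ⟨h, ha, hc⟩ := mem_Sset_succ.1 ha
    exact ⟨ha, by rw [hc, ← index_lt_iff hr hj hj' h]; omega⟩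
  · rintro ⟨ha, hle⟩
    obtain ⟨i, h, hc⟩ := exists_index (c := c) (l := l) ha
    rw [hc, ← index_lt_iff hr hj hj' h] at hle
    exact ⟨i + 1, ⟨by omega, by omega⟩, mem_Sset_succ.2 ⟨h, ha, hc⟩⟩

/-- This form does not involve j and is continuous in u, which is why the first law converges at the
thresholds too. -/
theorem limitLaw₁_eq {lam : ℝ} (hr : 0 < r v) {j : ℕ} {u : ℝ} (hj : d v c l r j ≤ u)
    (hj' : u < d v c l r (j + 1)) :
    limitLaw₁ v c lam l r j u =
      ∑ a ∈ S.pairsFrom v, min (cbar c l a) (u / r v) * (r (S.t a.2) / lam ^ 2) := by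
  classical
  have h1 : (Finset.Icc 1 j).biUnion (Sset v c l) =
      {a ∈ S.pairsFrom v | cbar c l a * r v ≤ u} := by
    ext a
    rw [mem_biUnion_Sset_iff hr hj hj', Finset.mem_filter]
  have h2 : (Finset.Icc (j + 1) (cvals v c l).card).biUnion (Sset v c l) =
      {a ∈ S.pairsFrom v | ¬ cbar c l a * r v ≤ u} := by
    ext a
    rw [mem_biUnion_Sset_iff_not hr hj hj', Finset.mem_filter]
  rw [limitLaw₁]
  convert (Finset.sum_filter_add_sum_filter_not (S.pairsFrom v)
    (fun a => cbar c l a * r v ≤ u) _) using 2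
  · refine Finset.sum_congr (by convert h1) fun a ha => ?_
    rw [min_eq_left ((le_div_iff₀ hr).2 (Finset.mem_filter.1 ha).2)]
  · rw [Finset.mul_sum]
    refine Finset.sum_congr (by convert h2) fun a ha => ?_
    rw [min_eq_right ((div_le_iff₀ hr).2 (not_le.1 (Finset.mem_filter.1 ha).2).le)]

end Thresholds

/-! ### The entrance laws of the cylinders -/

theorem sum_pathsFrom_one {v : Fin m} (f : S.E × S.E → ℝ) :
    ∑ e ∈ S.pathsFrom v 1, f (e 0, e 1) = ∑ a ∈ S.pairsFrom v, f a := by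
  refine Finset.sum_bij' (fun e _ => (e 0, e 1)) (fun a _ => ![a.1, a.2]) ?_ ?_ ?_ ?_ ?_
  · intro e he
    obtain ⟨h1, h2⟩ := mem_pathsFrom.1 he
    exact mem_pairsFrom.2 ⟨h1, h2 0⟩
  · intro a ha
    obtain ⟨h1, h2⟩ := mem_pairsFrom.1 ha
    refine mem_pathsFrom.2 ⟨h1, fun b => ?_⟩
    obtain rfl : b = 0 := Subsingleton.elim _ _
    exact h2
  · intro e _
    funext b
    fin_cases b <;> rfl
  · intro a _
    rfl
  · intro e _
    rfl

variable [NeZero m] {hS : S.toDiagram.ProperlyOrdered} {μ : Measure S.X} [IsProbabilityMeasure μ]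
  {lam : ℝ} {r l : Fin m → ℝ} {x : S.X} {v : Fin m}

theorem returnPath_mem_pairsFrom (h1 : S.H1) (h2 : S.H2) (h3 : S.H3) {p : ℕ} (hx : term x p = v)
    {k : ℕ} (hk : 1 ≤ k) {e : Fin (k + 1) → S.E} (he : e ∈ S.pathsFrom v k) :
    returnPath hS v k e ∈ S.pairsFrom v := by
  obtain ⟨z, hz, hze⟩ := exists_mem_cyl h2 hx he
  obtain ⟨h4, h5⟩ := returnPath_spec (hS := hS) h1 h2 h3 hx hz hk
  rw [show e = fun a : Fin (k + 1) => edge z (p + a) from funext fun a => (hze a).symm, h5]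
  refine mem_pairsFrom.2 ⟨?_, target_edge _ p⟩
  rw [← term_eq_source, ((mem_cyl_iff h2).1 h4).1, hx]

theorem cbar_pos (h1 : S.H1) (h2 : S.H2) (h3 : S.H3) (hl_pos : ∀ i, 0 < l i) {p : ℕ}
    (hx : term x p = v) {a : S.E × S.E} (ha : a ∈ S.pairsFrom v) :
    0 < cbar (passageCount hS v) l a := by
  obtain ⟨h4, h5⟩ := mem_pairsFrom.1 ha
  have he : ![a.1, a.2] ∈ S.pathsFrom v 1 := by
    refine mem_pathsFrom.2 ⟨h4, fun b => ?_⟩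
    obtain rfl : b = 0 := Subsingleton.elim _ _
    exact h5
  obtain ⟨z, hz, hze⟩ := exists_mem_cyl h2 hx he
  rw [cyl_eq h2 hx] at hz
  have hpos := passageCount_pos (hS := hS) h1 h2 h3 hz.1
  have e0 : edge (tail h2 p z) 0 = a.1 := hze 0
  have e1 : edge (tail h2 p z) 1 = a.2 := hze 1
  rw [e0, e1] at hpos
  refine Finset.sum_pos' (fun i _ => mul_nonneg (Nat.cast_nonneg _) (hl_pos i).le)
    ⟨v, Finset.mem_univ v, mul_pos (Nat.cast_pos.2 hpos) (hl_pos v)⟩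

theorem tendsto_returnTime (h1 : S.H1) (hr : Matrix.mulVec S.M r = lam • r)
    (hl : Matrix.vecMul l S.M = lam • l) (hr_pos : ∀ i, 0 < r i) (hl_pos : ∀ i, 0 < l i)
    (hr_sum : ∑ i, r i = 1) (hlr_sum : ∑ i, l i * r i = 1) (a : S.E × S.E) :
    Tendsto (fun p => (returnTime hS v p a : ℝ) / lam ^ p) atTop
      (𝓝 (cbar (passageCount hS v) l a)) := by
  have h : Tendsto (fun p => ∑ i, (passageCount hS v a.1 a.2 i : ℝ) * ((hgt S p i : ℝ) / lam ^ p))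
      atTop (𝓝 (cbar (passageCount hS v) l a)) :=
    tendsto_finsetSum _ fun i _ =>
      (tendsto_hgt h1 hr hl hr_pos hl_pos hr_sum hlr_sum i).const_mul _
  refine h.congr fun p => ?_
  rw [returnTime, Nat.cast_sum, Finset.sum_div]
  refine Finset.sum_congr rfl fun i _ => ?_
  rw [Nat.cast_mul, mul_div_assoc]

theorem measureReal_cylExt (h1 : S.H1) (h2 : S.H2)
    (hμ : MeasurePreserving (vershik hS) μ μ) (hr : Matrix.mulVec S.M r = lam • r)
    (hl : Matrix.vecMul l S.M = lam • l) (hr_pos : ∀ i, 0 < r i) (hl_pos : ∀ i, 0 < l i)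
    (hr_sum : ∑ i, r i = 1) {p : ℕ} (hx : term x p = v) {k : ℕ} {e : Fin (k + 1) → S.E}
    (he : e ∈ S.pathsFrom v k) :
    μ.real (cylExt x p e) = r (S.t (e (Fin.last k))) / lam ^ (p + k + 1) := by
  obtain ⟨z, hz, hzt⟩ := exists_cylExt_eq h2 hx he
  rw [hz, measureReal_cyl h1 h2 hμ hr hl hr_pos hl_pos hr_sum, hzt]

theorem entranceTime_cylExt (h1 : S.H1) (h2 : S.H2) (h3 : S.H3) {p : ℕ} (hx : term x p = v) {k : ℕ}
    {e : Fin (k + 1 + 1) → S.E} {z : S.X} (hz : z ∈ cylExt x p e) :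
    entranceTime (vershik hS) (cyl x (p + 1)) 1 z = returnTime hS v p (e 0, e 1) := by
  rw [entranceTime_cyl h1 h2 h3 hx hz.1, ← hz.2 0, ← hz.2 1]
  rfl

/-- An exact formula at finite level: entrance times are integers, so the bound u / μ(I) may be
replaced by its floor, and the factor 1 / lam ^ p of the atoms normalises the times. -/
theorem entranceLaw_one_eq (h1 : S.H1) (h2 : S.H2) (h3 : S.H3)
    (hμ : MeasurePreserving (vershik hS) μ μ) (hr : Matrix.mulVec S.M r = lam • r)
    (hl : Matrix.vecMul l S.M = lam • l) (hr_pos : ∀ i, 0 < r i) (hl_pos : ∀ i, 0 < l i)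
    (hr_sum : ∑ i, r i = 1) {p : ℕ} (hx : term x p = v) {u : ℝ} (hu : 0 ≤ u) :
    entranceLaw (vershik hS) μ (cyl x (p + 1)) 1 u =
      ∑ a ∈ S.pairsFrom v, min ((returnTime hS v p a : ℝ) / lam ^ p)
        ((⌊u / r v * lam ^ p⌋₊ : ℝ) / lam ^ p) * (r (S.t a.2) / lam ^ 2) := by
  classical
  have hlam := lam_pos h1 hr hr_pos
  have hpow := pow_pos hlam p
  have hset : {y | μ.real (cyl x (p + 1)) * ((entranceTime (vershik hS) (cyl x (p + 1)) 1 y : ℝ) -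
      (entranceTime (vershik hS) (cyl x (p + 1)) (1 - 1) y : ℝ)) ≤ u} =
      {y | entranceTime (vershik hS) (cyl x (p + 1)) 1 y ≤ ⌊u / r v * lam ^ p⌋₊ ∧
        (vershik hS)^[entranceTime (vershik hS) (cyl x (p + 1)) 1 y] y ∈ Set.univ} := by
    ext y
    simp only [Set.mem_ofPred_eq, Set.mem_univ, and_true]
    rw [Nat.le_floor_iff (mul_nonneg (div_nonneg hu (hr_pos v).le) hpow.le),
      measureReal_cyl h1 h2 hμ hr hl hr_pos hl_pos hr_sum, hx, Nat.sub_self]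
    simp only [entranceTime, Nat.cast_zero, sub_zero]
    rw [div_mul_eq_mul_div, div_le_iff₀ hpow, div_mul_eq_mul_div, le_div_iff₀ (hr_pos v), mul_comm]
  rw [entranceLaw, hset, measureReal_entranceTime_le (S.pathsFrom v 1) (cylExt x p)
    (fun e => returnTime hS v p (e 0, e 1)) (fun _ => True) hμ (measurableSet_cyl _ _)
    (cyl_recurrent hS h1 h2 x p) MeasurableSet.univ
    (fun e he => by
      obtain ⟨z, hz, -⟩ := exists_cylExt_eq h2 hx he
      rw [hz]
      exact measurableSet_cyl _ _)
    (pairwiseDisjoint_cylExt x p _) (iUnion_cylExt hx 1)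
    (fun e _ z hz => entranceTime_cylExt h1 h2 h3 hx hz) (fun _ _ _ _ => by simp),
    Finset.filter_true_of_mem fun _ _ => trivial, ← sum_pathsFrom_one]
  refine Finset.sum_congr rfl fun e he => ?_
  rw [measureReal_cylExt h1 h2 hμ hr hl hr_pos hl_pos hr_sum hx he, Nat.cast_min,
    min_div_div_right hpow.le, div_mul_div_comm, ← pow_add, mul_div_assoc]
  rfl

/-- For k ≥ 2 the gap is a function of the first entrance point alone. An excursion is therefore
counted entirely or not at all: its weight is its own length, read from e₁e₂, and the condition is
on the length of its k-th successor, counting itself as the first. -/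
theorem entranceLaw_eq (h1 : S.H1) (h2 : S.H2) (h3 : S.H3)
    (hμ : MeasurePreserving (vershik hS) μ μ) (hr : Matrix.mulVec S.M r = lam • r)
    (hl : Matrix.vecMul l S.M = lam • l) (hr_pos : ∀ i, 0 < r i) (hl_pos : ∀ i, 0 < l i)
    (hr_sum : ∑ i, r i = 1) {p : ℕ} (hx : term x p = v) {k : ℕ} (hk : 2 ≤ k) (u : ℝ)
    [DecidablePred fun e : Fin (k + 1) → S.E =>
      (returnTime hS v p (returnPath hS v k e) : ℝ) / lam ^ p * r v ≤ u] :
    entranceLaw (vershik hS) μ (cyl x (p + 1)) k u =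
      ∑ e ∈ S.pathsFrom v k with (returnTime hS v p (returnPath hS v k e) : ℝ) / lam ^ p * r v ≤ u,
        (returnTime hS v p (e 0, e 1) : ℝ) / lam ^ p *
          (r (S.t (e (Fin.last k))) / lam ^ (k + 1)) := by
  have hrec := cyl_recurrent hS h1 h2 x p
  have hpow := pow_pos (lam_pos h1 hr hr_pos) p
  have hmeas := measurable_entranceTime hμ.measurable (measurableSet_cyl x (p + 1)) hrec
  obtain ⟨k, rfl⟩ := Nat.exists_eq_add_of_le' hk
  -- The index k has been lowered by two, so A bounds the gap of order one less than the law's.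
  set A : Set S.X := {y | μ.real (cyl x (p + 1)) *
    ((entranceTime (vershik hS) (cyl x (p + 1)) (k + 1) y : ℝ) -
      (entranceTime (vershik hS) (cyl x (p + 1)) k y : ℝ)) ≤ u}
  have hAm : MeasurableSet A := by
    refine measurableSet_le (measurable_const.mul ?_) measurable_const
    exact (measurable_from_top.comp (hmeas (k + 1))).sub (measurable_from_top.comp (hmeas k))
  have hiff : ∀ y, (vershik hS)^[entranceTime (vershik hS) (cyl x (p + 1)) 1 y] y ∈ A ↔
      μ.real (cyl x (p + 1)) * ((entranceTime (vershik hS) (cyl x (p + 1)) (k + 2) y : ℝ) -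
      (entranceTime (vershik hS) (cyl x (p + 1)) (k + 2 - 1) y : ℝ)) ≤ u := by
    intro y
    rw [entranceTime_succ' hrec (k + 1) y, show k + 2 - 1 = k + 1 from rfl,
      entranceTime_succ' hrec k y, Nat.cast_add, Nat.cast_add, add_sub_add_left_eq_sub]
    rfl
  have hset : {y | μ.real (cyl x (p + 1)) *
      ((entranceTime (vershik hS) (cyl x (p + 1)) (k + 2) y : ℝ) -
      (entranceTime (vershik hS) (cyl x (p + 1)) (k + 2 - 1) y : ℝ)) ≤ u} =
      {y | (vershik hS)^[entranceTime (vershik hS) (cyl x (p + 1)) 1 y] y ∈ A} := by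
    ext y
    exact (hiff y).symm
  rw [entranceLaw, hset, measureReal_entrance (S.pathsFrom v (k + 2)) (cylExt x p)
    (fun e => returnTime hS v p (e 0, e 1))
    (fun e => (returnTime hS v p (returnPath hS v (k + 2) e) : ℝ) / lam ^ p * r v ≤ u)
    hμ (measurableSet_cyl _ _) hrec hAm
    (fun e he => by
      obtain ⟨z, hz, -⟩ := exists_cylExt_eq h2 hx he
      rw [hz]
      exact measurableSet_cyl _ _)
    (pairwiseDisjoint_cylExt x p _) (iUnion_cylExt hx (k + 2))
    (fun e _ z hz => entranceTime_cylExt h1 h2 h3 hx hz)]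
  · refine Finset.sum_congr rfl fun e he => ?_
    rw [measureReal_cylExt h1 h2 hμ hr hl hr_pos hl_pos hr_sum hx (Finset.mem_filter.1 he).1,
      div_mul_div_comm, ← pow_add, mul_div_assoc]
    rfl
  · intro e _ z hz
    rw [hiff, entranceTime_cyl_sub h1 h2 h3 hx hz.1 (by omega), Nat.cast_add, add_sub_cancel_left,
      measureReal_cyl h1 h2 hμ hr hl hr_pos hl_pos hr_sum, hx,
      show (fun a : Fin (k + 2 + 1) => edge z (p + a)) = e from funext hz.2, div_mul_eq_mul_div,
      div_mul_eq_mul_div, mul_comm (r v)]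

/-! ### Convergence -/

theorem tendstoUniformlyOn_entranceLaw_one [Infinite S.X] (h1 : S.H1) (h2 : S.H2) (h3 : S.H3)
    (hμ : MeasurePreserving (vershik hS) μ μ) (hr : Matrix.mulVec S.M r = lam • r)
    (hl : Matrix.vecMul l S.M = lam • l) (hr_pos : ∀ i, 0 < r i) (hl_pos : ∀ i, 0 < l i)
    (hr_sum : ∑ i, r i = 1) (hlr_sum : ∑ i, l i * r i = 1) {p : ℕ → ℕ} (hp : Tendsto p atTop atTop)
    (hx : ∀ i, term x (p i) = v) {K : Set ℝ} (hK : ∀ u ∈ K, 0 ≤ u) :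
    TendstoUniformlyOn (fun i u => entranceLaw (vershik hS) μ (cyl x (p i + 1)) 1 u)
      (fun u => ∑ a ∈ S.pairsFrom v, min (cbar (passageCount hS v) l a) (u / r v) *
        (r (S.t a.2) / lam ^ 2)) atTop K := by
  have hlam := one_lt_lam h1 h2 hr hr_pos
  have hlam0 : 0 < lam := by linarith
  -- An error bound free of u: the minimum is 1-Lipschitz, and rounding costs at most 1 / lam ^ q,
  -- which vanishes because lam > 1.
  set b : ℕ → ℝ := fun q => ∑ a ∈ S.pairsFrom v,
    (|(returnTime hS v q a : ℝ) / lam ^ q - cbar (passageCount hS v) l a| + (lam ^ q)⁻¹) *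
      (r (S.t a.2) / lam ^ 2) with hb
  have hb0 : Tendsto b atTop (𝓝 0) := by
    have h : Tendsto b atTop (𝓝 (∑ a ∈ S.pairsFrom v, (0 + 0) * (r (S.t a.2) / lam ^ 2))) := by
      refine tendsto_finsetSum _ fun a _ => Tendsto.mul_const _ (Tendsto.add ?_ ?_)
      · have := (tendsto_returnTime (hS := hS) (v := v) h1 hr hl hr_pos hl_pos hr_sum hlr_sum
          a).sub_const (cbar (passageCount hS v) l a)
        rw [sub_self] at this
        simpa using this.abs
      · exact (tendsto_pow_atTop_atTop_of_one_lt hlam).inv_tendsto_atTop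
    simpa using h
  rw [Metric.tendstoUniformlyOn_iff]
  intro ε hε
  filter_upwards [(hb0.comp hp).eventually (gt_mem_nhds hε)] with i hi u hu
  refine lt_of_le_of_lt ?_ hi
  rw [entranceLaw_one_eq h1 h2 h3 hμ hr hl hr_pos hl_pos hr_sum (hx i) (hK u hu), dist_comm,
    Real.dist_eq, ← Finset.sum_sub_distrib, Function.comp, hb]
  refine (Finset.abs_sum_le_sum_abs _ _).trans (Finset.sum_le_sum fun a _ => ?_)
  have hpow := pow_pos hlam0 (p i)
  rw [← sub_mul, abs_mul, abs_of_pos (div_pos (hr_pos (S.t a.2)) (pow_pos hlam0 2))]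
  refine mul_le_mul_of_nonneg_right ?_ (div_pos (hr_pos (S.t a.2)) (pow_pos hlam0 2)).le
  refine (abs_min_sub_min_le_max _ _ _ _).trans (max_le ?_ ?_)
  · exact le_add_of_nonneg_right (inv_nonneg.2 hpow.le)
  · refine le_trans ?_ (le_add_of_nonneg_left (abs_nonneg _))
    have hnn : 0 ≤ u / r v * lam ^ p i := mul_nonneg (div_nonneg (hK u hu) (hr_pos v).le) hpow.le
    have hf1 := Nat.floor_le hnn
    have hf2 := (Nat.lt_floor_add_one (u / r v * lam ^ p i)).le
    have heq : (⌊u / r v * lam ^ p i⌋₊ : ℝ) / lam ^ p i - u / r v =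
        (⌊u / r v * lam ^ p i⌋₊ - u / r v * lam ^ p i) / lam ^ p i := by
      rw [sub_div, mul_div_cancel_right₀ _ hpow.ne']
    rw [heq, abs_div, abs_of_pos hpow, ← one_div]
    refine div_le_div_of_nonneg_right ?_ hpow.le
    rw [abs_le]
    constructor <;> linarith

/-- Eventually the finite-level thresholds lie on the same side of each point of K as their limits.
The law is then constant on K, and uniformity reduces to convergence of the numbers `b i`. -/
theorem tendstoUniformlyOn_entranceLaw (h1 : S.H1) (h2 : S.H2) (h3 : S.H3)
    (hμ : MeasurePreserving (vershik hS) μ μ) (hr : Matrix.mulVec S.M r = lam • r)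
    (hl : Matrix.vecMul l S.M = lam • l) (hr_pos : ∀ i, 0 < r i) (hl_pos : ∀ i, 0 < l i)
    (hr_sum : ∑ i, r i = 1) (hlr_sum : ∑ i, l i * r i = 1) {p : ℕ → ℕ} (hp : Tendsto p atTop atTop)
    (hx : ∀ i, term x (p i) = v) {k : ℕ} (hk : 2 ≤ k) {j : ℕ} {K : Set ℝ} (hKc : IsClosed K)
    (hK : ∀ u ∈ K, d v (passageCount hS v) l r j ≤ u ∧ u < d v (passageCount hS v) l r (j + 1))
    (hK' : ∀ a ∈ S.pairsFrom v, cbar (passageCount hS v) l a * r v ∉ K) :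
    TendstoUniformlyOn (fun i u => entranceLaw (vershik hS) μ (cyl x (p i + 1)) k u)
      (fun _ => limitLaw v (passageCount hS v) (returnPath hS v) lam l r k j) atTop K := by
  classical
  have hlim := fun a => (tendsto_returnTime (hS := hS) (v := v) h1 hr hl hr_pos hl_pos hr_sum
    hlr_sum a).comp hp
  set b : ℕ → ℝ := fun i => ∑ e ∈ S.pathsFrom v k with
    returnPath hS v k e ∈ (Finset.Icc 1 j).biUnion (Sset v (passageCount hS v) l),
      (returnTime hS v (p i) (e 0, e 1) : ℝ) / lam ^ (p i) *
        (r (S.t (e (Fin.last k))) / lam ^ (k + 1)) with hb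
  have hblim : Tendsto b atTop
      (𝓝 (limitLaw v (passageCount hS v) (returnPath hS v) lam l r k j)) := by
    rw [limitLaw]
    convert tendsto_finsetSum (S.pathsFrom v k |>.filter fun e => returnPath hS v k e ∈
      (Finset.Icc 1 j).biUnion (Sset v (passageCount hS v) l)) fun e _ =>
      (hlim (e 0, e 1)).mul_const (r (S.t (e (Fin.last k))) / lam ^ (k + 1)) using 1
    rfl
  have hev : ∀ a ∈ S.pairsFrom v, ∀ᶠ i in atTop, ∀ u ∈ K,
      ((returnTime hS v (p i) a : ℝ) / lam ^ (p i) * r v ≤ u ↔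
        cbar (passageCount hS v) l a * r v ≤ u) := by
    intro a ha
    -- Closedness of K gives a whole ball around the limiting threshold that misses K.
    have h4 : Kᶜ ∈ 𝓝 (cbar (passageCount hS v) l a * r v) := hKc.isOpen_compl.mem_nhds (hK' a ha)
    obtain ⟨ε, hε, hball⟩ := Metric.mem_nhds_iff.1 h4
    have h5 := ((hlim a).mul_const (r v)).eventually (Metric.ball_mem_nhds _ hε)
    filter_upwards [h5] with i hi u hu
    have h6 : ε ≤ |u - cbar (passageCount hS v) l a * r v| := by
      by_contra! hlt
      exact hball (by rwa [Metric.mem_ball, Real.dist_eq]) hu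
    rw [Real.dist_eq, abs_lt] at hi
    simp only [Function.comp] at hi
    rcases le_abs.1 h6 with h7 | h7
    · exact ⟨fun _ => by linarith, fun _ => by linarith [hi.2]⟩
    · constructor
      · intro h8
        linarith [hi.1]
      · intro h8
        linarith
  have hev' : ∀ᶠ i in atTop, ∀ u ∈ K,
      entranceLaw (vershik hS) μ (cyl x (p i + 1)) k u = b i := by
    have := (Finset.eventually_all (S.pairsFrom v)).2 hev
    filter_upwards [this] with i hi u hu
    rw [entranceLaw_eq h1 h2 h3 hμ hr hl hr_pos hl_pos hr_sum (hx i) hk, hb]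
    refine Finset.sum_congr (Finset.filter_congr fun e he => ?_) fun _ _ => rfl
    have hmem := returnPath_mem_pairsFrom (hS := hS) h1 h2 h3 (hx i) (by omega) he
    rw [hi _ hmem u hu, mem_biUnion_Sset_iff (hr_pos v) (hK u hu).1 (hK u hu).2]
    exact (and_iff_right hmem).symm
  rw [Metric.tendstoUniformlyOn_iff]
  intro ε hε
  filter_upwards [hev', hblim.eventually (Metric.ball_mem_nhds _ hε)] with i hi hi' u hu
  rw [hi u hu, dist_comm]
  exact hi'

end StationaryDiagram

/-! ### The limit theorem -/

theorem theorem2p4 {m : ℕ} [NeZero m] (S : StationaryDiagram m)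
    (hS : S.toDiagram.ProperlyOrdered) (hinf : Infinite S.X)
    (h1 : S.H1) (h2 : S.H2) (h3 : S.H3)
    (lam : ℝ) (r l : Fin m → ℝ)
    (hr : Matrix.mulVec S.M r = lam • r) (hl : Matrix.vecMul l S.M = lam • l)
    (hr_pos : ∀ i, 0 < r i) (hl_pos : ∀ i, 0 < l i)
    (hr_sum : ∑ i, r i = 1) (hlr_sum : ∑ i, l i * r i = 1)
    (μ : MeasureTheory.Measure S.X) [MeasureTheory.IsProbabilityMeasure μ]
    (hμ : MeasureTheory.MeasurePreserving (OrderedBratteliDiagram.vershik hS) μ μ)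
    (x : S.X) (v : Fin m) (ν : ℕ → ℕ) (hν : StrictMono ν)
    (hv : ∀ i, StationaryDiagram.EndsAt x (ν i) v) :
    ∃ (c : S.E → S.E → Fin m → ℕ) (g : ∀ k : ℕ, (Fin (k + 1) → S.E) → S.E × S.E),
      S.IsPassageCount hS v c ∧ S.IsReturnPath hS v g ∧
      ∀ j ≤ (StationaryDiagram.cvals v c l).card,
        -- the first entrance time
        (∀ u : ℝ, StationaryDiagram.d v c l r j ≤ (u : EReal) →
          (u : EReal) < StationaryDiagram.d v c l r (j + 1) →
          Filter.Tendsto (fun i => entranceLaw (OrderedBratteliDiagram.vershik hS) μ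
              (OrderedBratteliDiagram.cyl x (ν i)) 1 u)
            Filter.atTop (nhds (StationaryDiagram.limitLaw₁ v c lam l r j u))) ∧
        (∀ K : Set ℝ, IsClosed K →
          (∀ u ∈ K, StationaryDiagram.d v c l r j < (u : EReal) ∧
            (u : EReal) < StationaryDiagram.d v c l r (j + 1)) →
          TendstoUniformlyOn (fun i u => entranceLaw (OrderedBratteliDiagram.vershik hS) μ
              (OrderedBratteliDiagram.cyl x (ν i)) 1 u)
            (fun u => StationaryDiagram.limitLaw₁ v c lam l r j u) Filter.atTop K) ∧
        -- the later return times
        ∀ k : ℕ, 2 ≤ k →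
          (∀ u : ℝ, StationaryDiagram.d v c l r j ≤ (u : EReal) →
            (u : EReal) < StationaryDiagram.d v c l r (j + 1) →
            (1 ≤ j → (u : EReal) ≠ StationaryDiagram.d v c l r j) →
            Filter.Tendsto (fun i => entranceLaw (OrderedBratteliDiagram.vershik hS) μ
                (OrderedBratteliDiagram.cyl x (ν i)) k u)
              Filter.atTop (nhds (StationaryDiagram.limitLaw v c g lam l r k j))) ∧
          (∀ K : Set ℝ, IsClosed K →
            (∀ u ∈ K, StationaryDiagram.d v c l r j < (u : EReal) ∧
              (u : EReal) < StationaryDiagram.d v c l r (j + 1)) →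
            TendstoUniformlyOn (fun i u => entranceLaw (OrderedBratteliDiagram.vershik hS) μ
                (OrderedBratteliDiagram.cyl x (ν i)) k u)
              (fun _ => StationaryDiagram.limitLaw v c g lam l r k j) Filter.atTop K) := by
  choose p hp hpt using hv
  obtain rfl : ν = fun i => p i + 1 := funext hp
  have hpt' : Filter.Tendsto p Filter.atTop Filter.atTop :=
    (show StrictMono p from fun i j hij => Nat.lt_of_succ_lt_succ (hν hij)).tendsto_atTop
  -- Guarantees u ≥ 0, which the floor formula for the first law requires.
  have hd0 : ∀ j, 0 ≤ StationaryDiagram.d v (StationaryDiagram.passageCount hS v) l r j := by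
    intro j
    cases j with
    | zero => exact le_rfl
    | succ j =>
      by_cases h : j < (StationaryDiagram.cvals v (StationaryDiagram.passageCount hS v) l).card
      · rw [StationaryDiagram.d_succ_of_lt h]
        refine EReal.coe_nonneg.2 (mul_nonneg ?_ (hr_pos v).le)
        have hmem := Finset.orderEmbOfFin_mem
          (StationaryDiagram.cvals v (StationaryDiagram.passageCount hS v) l) rfl ⟨j, h⟩
        obtain ⟨a, ha, hac⟩ := Finset.mem_image.1 hmem
        rw [← hac]
        exact (StationaryDiagram.cbar_pos h1 h2 h3 hl_pos (hpt 0) ha).le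
      · rw [StationaryDiagram.d, dif_neg h]
        exact le_top
  refine ⟨StationaryDiagram.passageCount hS v, StationaryDiagram.returnPath hS v,
    StationaryDiagram.isPassageCount_passageCount h1 h2 h3 v,
    StationaryDiagram.isReturnPath_returnPath h1 h2 h3 v, fun j hj => ?_⟩
  have hfirst : ∀ K : Set ℝ, (∀ u ∈ K,
      StationaryDiagram.d v (StationaryDiagram.passageCount hS v) l r j ≤ (u : EReal) ∧
      (u : EReal) < StationaryDiagram.d v (StationaryDiagram.passageCount hS v) l r (j + 1)) →
      TendstoUniformlyOn (fun i u => entranceLaw (OrderedBratteliDiagram.vershik hS) μ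
        (OrderedBratteliDiagram.cyl x (p i + 1)) 1 u)
      (fun u => StationaryDiagram.limitLaw₁ v (StationaryDiagram.passageCount hS v) lam l r j u)
      Filter.atTop K := by
    intro K hK
    refine (StationaryDiagram.tendstoUniformlyOn_entranceLaw_one h1 h2 h3 hμ hr hl hr_pos hl_pos
      hr_sum hlr_sum hpt' hpt fun u hu => EReal.coe_nonneg.1 ((hd0 j).trans (hK u hu).1)).congr_right
      fun u hu => ?_
    exact (StationaryDiagram.limitLaw₁_eq (hr_pos v) (hK u hu).1 (hK u hu).2).symm
  -- The only jump that can lie in [d_j, d_{j+1}[ is d_j itself, and only if j ≥ 1: a jump at u has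
  -- index at most j, hence is at most d_j ≤ u.
  have hcrossing : ∀ u : ℝ,
      StationaryDiagram.d v (StationaryDiagram.passageCount hS v) l r j ≤ (u : EReal) →
      (u : EReal) < StationaryDiagram.d v (StationaryDiagram.passageCount hS v) l r (j + 1) →
      (1 ≤ j → (u : EReal) ≠ StationaryDiagram.d v (StationaryDiagram.passageCount hS v) l r j) →
      ∀ a ∈ S.pairsFrom v,
        StationaryDiagram.cbar (StationaryDiagram.passageCount hS v) l a * r v ≠ u := by
    rintro u hu hu' hne a ha rfl
    obtain ⟨i, h, hc⟩ := StationaryDiagram.exists_index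
      (c := StationaryDiagram.passageCount hS v) (l := l) ha
    have hij := (StationaryDiagram.index_lt_iff (hr_pos v) hu hu' h).2 (by rw [hc])
    obtain ⟨q, rfl⟩ := Nat.exists_eq_add_of_lt (Nat.zero_lt_of_lt hij)
    rw [zero_add] at hu hu' hne hij hj
    refine hne (by omega) (le_antisymm ?_ hu)
    rw [StationaryDiagram.d_succ_of_lt hj, hc, EReal.coe_le_coe_iff]
    refine mul_le_mul_of_nonneg_right ?_ (hr_pos v).le
    exact (Finset.orderEmbOfFin _ rfl).monotone (Fin.mk_le_mk.2 (by omega))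
  refine ⟨fun u hu hu' => ?_, fun K _ hK => hfirst K fun u hu => ⟨(hK u hu).1.le, (hK u hu).2⟩,
    fun k hk => ⟨fun u hu hu' hne => ?_, fun K hKc hK => ?_⟩⟩
  · exact (hfirst {u} (by rintro _ rfl; exact ⟨hu, hu'⟩)).tendsto_at rfl
  -- Pointwise convergence is uniform convergence on the closed set {u}; this also covers t = d_0 =
  -- 0.
  · refine (StationaryDiagram.tendstoUniformlyOn_entranceLaw h1 h2 h3 hμ hr hl hr_pos hl_pos
      hr_sum hlr_sum hpt' hpt hk (isClosed_singleton (x := u)) (j := j) ?_ ?_).tendsto_at rfl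
    · rintro _ rfl
      exact ⟨hu, hu'⟩
    · exact fun a ha h => hcrossing u hu hu' hne a ha h
  · refine StationaryDiagram.tendstoUniformlyOn_entranceLaw h1 h2 h3 hμ hr hl hr_pos hl_pos
      hr_sum hlr_sum hpt' hpt hk hKc (fun u hu => ⟨(hK u hu).1.le, (hK u hu).2⟩) ?_
    intro a ha hmem
    exact hcrossing _ (hK _ hmem).1.le (hK _ hmem).2 (fun _ => (hK _ hmem).1.ne') a ha rfl
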